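/- Throughout, $p\in[1,\infty)$. A graph $Q=(Q^0,Q^1,\mathsf r,\mathsf s)$ consists of a set $Q^0$ of vertices, a set $Q^1$ of edges and range and source maps $\mathsf r,\mathsf s\colon Q^1\to Q^0$; it is countable if $Q^0$ and $Q^1$ are countable (possibly finite). A vertex $v$ is regular if $0<|\mathsf r^{-1}(v)|<\infty$. A cycle is a finite sequence $\alpha_1,\dots,\alpha_n$ ($n\ge1$) of pairwise distinct edges with $\mathsf s(\alpha_i)=\mathsf r(\alpha_{i+1})$ for $i<n$ and $\mathsf s(\alpha_n)=\mathsf r(\alpha_1)$; it has an entry if there are an edge $a$ and an index $i$ with $\mathsf r(a)=\mathsf r(\alpha_i)$ and $a\ne\alpha_i$. A subgraph $R\subseteq Q$ is a Cuntz--Krieger subgraph if $\mathsf r_R^{-1}(v)=\mathsf r_Q^{-1}(v)$ for every $v\in R^0$ with $0<|\mathsf r_R^{-1}(v)|<\infty$. Subgraphs are ordered by inclusion. The Leavitt path algebra $L_Q$ is the universal (not necessarily unital) complex algebra generated by $s_a,t_a$ ($a\in Q^1$) and $e_v$ ($v\in Q^0$) subject to $e_ve_w=\delta_{v,w}e_v$,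 $e_{\mathsf r(a)}s_a=s_ae_{\mathsf s(a)}=s_a$, $t_ae_{\mathsf r(a)}=e_{\mathsf s(a)}t_a=t_a$, $t_as_b=\delta_{a,b}e_{\mathsf s(b)}$, and $e_v=\sum_{a\in\mathsf r^{-1}(v)}s_at_a$ for all regular $v$. A representation of $L_Q$ on an $L^p$-space $\mathcal E=L^p(\mu)$ (complex scalars, $\mu$ an arbitrary measure) is an algebra homomorphism $\varphi\colon L_Q\to\mathcal B(\mathcal E)$ such that the $\varphi(e_v)$ and all $\varphi(s_at_a)$, $\varphi(t_as_a)$ are hermitian idempotents and $\|\varphi(s_a)\|,\|\varphi(t_a)\|\le1$, where $h$ is hermitian if $\|\exp(i\lambda h)\|\le1$ for all $\lambda\in\mathbb R$. The algebra $\mathcal O^p(Q)$ is the completion of $L_Q$ in the norm $\|x\|=\sup\{\|\varphi(x)\|:\varphi\text{ a representation of }L_Q\text{ on an }L^p\text{-space}\}$. For a Cuntz--Krieger subgraph $R\subseteq Q$, the canonical map $L_R\to L_Q$ is the homomorphism that sends each generator of $L_R$ to the generator of $L_Q$ with the same name. (1) Let $Q$ be a countable graph and let $R\subseteq Q$ be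 a Cuntz--Krieger subgraph. Then the canonical map $L_R\to L_Q$ extends to an isometric homomorphism $\mathcal O^p(R)\to\mathcal O^p(Q)$. (2) Let $Q$ be an arbitrary graph, and let $\mathrm{CK}(Q)$ be the set of all countable Cuntz--Krieger subgraphs of $Q$. Then $\mathrm{CK}(Q)$ is directed under inclusion, the maps $\mathcal O^p(R)\to\mathcal O^p(R')$ (for $R\subseteq R'$ in $\mathrm{CK}(Q)$) and $\mathcal O^p(R)\to\mathcal O^p(Q)$ induced by the canonical maps are isometric homomorphisms, and with these maps $\mathcal O^p(Q)$ is the direct limit of the algebras $\mathcal O^p(R)$, $R\in\mathrm{CK}(Q)$: for every complex Banach algebra $B$, every family of isometric (respectively, contractive) homomorphisms $\psi_R\colon\mathcal O^p(R)\to B$, $R\in\mathrm{CK}(Q)$, that is compatible with the connecting maps is induced by a unique isometric (respectively, contractive) homomorphism $\mathcal O^p(Q)\to B$. (3) If every cycle in the graph $Q$ has an entry, then the assertions of (2) also hold with $\mathrm{CK}(Q)$ replaced by the set of all countable Cuntz--Krieger subgraphs of $Q$ in which every cycle has an entry. -/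

import Mathlib

open MeasureTheory
open scoped ENNReal

universe u v w

/-- A directed graph: a set of vertices, a set of edges, and range and source maps. -/
structure DirGraph where
  /-- the vertices -/
  V : Type u
  /-- the edges -/
  E : Type u
  /-- the range map -/
  r : E → V
  /-- the source map -/
  s : E → V

namespace DirGraph

/-- A graph is countable if its sets of vertices and of edges are countable (possibly finite). -/
def IsCountable (Q : DirGraph.{u}) : Prop := Countable Q.V ∧ Countable Q.E

/-- A sequence of edges `α 0, α 1, …, α n` is a cycle if `s (α i) = r (α (i+1))`, the source of
its last edge is the range of its first edge, and its edges are pairwise distinct. -/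
def IsCycle (Q : DirGraph.{u}) {n : ℕ} (α : Fin (n + 1) → Q.E) : Prop :=
  (∀ i : Fin n, Q.s (α i.castSucc) = Q.r (α i.succ)) ∧
    Q.s (α (Fin.last n)) = Q.r (α 0) ∧ Function.Injective α

/-- Every cycle has an entry: some edge `a` with `r a = r (α i)` and `a ≠ α i` for some `i`. -/
def EveryCycleHasEntry (Q : DirGraph.{u}) : Prop :=
  ∀ (n : ℕ) (α : Fin (n + 1) → Q.E), Q.IsCycle α →
    ∃ (a : Q.E) (i : Fin (n + 1)), Q.r a = Q.r (α i) ∧ a ≠ α i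

/-! ### Subgraphs -/

/-- A subgraph: sets of vertices and of edges, closed under range and source. -/
@[ext]
structure Subgraph (Q : DirGraph.{u}) where
  verts : Set Q.V
  edges : Set Q.E
  r_mem : ∀ a ∈ edges, Q.r a ∈ verts
  s_mem : ∀ a ∈ edges, Q.s a ∈ verts

namespace Subgraph

variable {Q : DirGraph.{u}}

/-- Subgraphs are ordered by inclusion. -/
instance : PartialOrder Q.Subgraph where
  le R R' := R.verts ⊆ R'.verts ∧ R.edges ⊆ R'.edges
  le_refl _ := ⟨subset_rfl, subset_rfl⟩
  le_trans _ _ _ h h' := ⟨h.1.trans h'.1, h.2.trans h'.2⟩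
  le_antisymm _ _ h h' :=
    Subgraph.ext (Set.Subset.antisymm h.1 h'.1) (Set.Subset.antisymm h.2 h'.2)

/-- A subgraph, regarded as a graph in its own right. -/
def toGraph (R : Q.Subgraph) : DirGraph.{u} where
  V := R.verts
  E := R.edges
  r a := ⟨Q.r a, R.r_mem a a.2⟩
  s a := ⟨Q.s a, R.s_mem a a.2⟩

/-- `R` is a Cuntz–Krieger subgraph of `Q` if for every vertex `v` of `R` which receives
at least one and at most finitely many edges in `R`, all edges of `Q` with range `v` lie in `R`. -/
def IsCuntzKrieger (R : Q.Subgraph) : Prop :=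
  ∀ v ∈ R.verts, {a ∈ R.edges | Q.r a = v}.Nonempty → {a ∈ R.edges | Q.r a = v}.Finite →
    {a ∈ R.edges | Q.r a = v} = {a | Q.r a = v}

end Subgraph

/-- An embedding of graphs whose image is a Cuntz–Krieger subgraph of the target. -/
structure CKEmbedding (G H : DirGraph.{u}) where
  onV : G.V → H.V
  onE : G.E → H.E
  onV_injective : Function.Injective onV
  onE_injective : Function.Injective onE
  r_onE : ∀ a, H.r (onE a) = onV (G.r a)
  s_onE : ∀ a, H.s (onE a) = onV (G.s a)
  isCuntzKrieger : ∀ v : G.V, {a | G.r a = v}.Nonempty → {a | G.r a = v}.Finite →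
    ∀ b : H.E, H.r b = onV v → ∃ a, onE a = b

namespace Subgraph

variable {Q : DirGraph.{u}}

theorem IsCuntzKrieger.mem {R : Q.Subgraph} (hR : R.IsCuntzKrieger) (v : R.toGraph.V)
    (hne : {a | R.toGraph.r a = v}.Nonempty) (hfin : {a | R.toGraph.r a = v}.Finite)
    (b : Q.E) (hb : Q.r b = v.1) : b ∈ R.edges := by
  have himg : {a ∈ R.edges | Q.r a = v.1} =
      (Subtype.val : R.edges → Q.E) '' {a : R.edges | R.toGraph.r a = v} := by
    ext a
    constructor
    · rintro ⟨h1, h2⟩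
      exact ⟨⟨a, h1⟩, Subtype.ext h2, rfl⟩
    · rintro ⟨c, hc, rfl⟩
      exact ⟨c.2, congrArg Subtype.val hc⟩
  have h := hR v.1 v.2 (himg ▸ hne.image _) (himg ▸ hfin.image _)
  have hb' : b ∈ {a | Q.r a = v.1} := hb
  rw [← h] at hb'
  exact hb'.1

/-- The inclusion of a Cuntz–Krieger subgraph. -/
def incl (R : Q.Subgraph) (hR : R.IsCuntzKrieger) : CKEmbedding R.toGraph Q where
  onV := Subtype.val
  onE := Subtype.val
  onV_injective := Subtype.val_injective
  onE_injective := Subtype.val_injective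
  r_onE _ := rfl
  s_onE _ := rfl
  isCuntzKrieger v hne hfin b hb := ⟨⟨b, hR.mem v hne hfin b hb⟩, rfl⟩

/-- The inclusion of a Cuntz–Krieger subgraph into a larger subgraph. -/
def inclOfLE {R R' : Q.Subgraph} (h : R ≤ R') (hR : R.IsCuntzKrieger) :
    CKEmbedding R.toGraph R'.toGraph where
  onV v := ⟨v.1, h.1 v.2⟩
  onE a := ⟨a.1, h.2 a.2⟩
  onV_injective _ _ e := Subtype.ext (Subtype.mk.inj e)
  onE_injective _ _ e := Subtype.ext (Subtype.mk.inj e)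
  r_onE _ := rfl
  s_onE _ := rfl
  isCuntzKrieger v hne hfin b hb :=
    ⟨⟨b.1, hR.mem v hne hfin b.1 (congrArg Subtype.val hb)⟩, rfl⟩

end Subgraph

/-- The set of all countable Cuntz–Krieger subgraphs of `Q`, ordered by inclusion. -/
abbrev CK (Q : DirGraph.{u}) : Type u :=
  {R : Q.Subgraph // R.IsCuntzKrieger ∧ R.toGraph.IsCountable}

/-- The set of all countable Cuntz–Krieger subgraphs of `Q` in which every cycle has an entry,
ordered by inclusion. -/
abbrev CKEntry (Q : DirGraph.{u}) : Type u :=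
  {R : Q.Subgraph // (R.IsCuntzKrieger ∧ R.toGraph.IsCountable) ∧ R.toGraph.EveryCycleHasEntry}

/-! ### Leavitt path algebras -/

/-- The defining relations of the Leavitt path algebra of `Q`, for a family of elements of a
(not necessarily unital) ring. -/
structure IsLeavittFamily (Q : DirGraph.{u}) {A : Type v} [NonUnitalRing A]
    (S T : Q.E → A) (P : Q.V → A) : Prop where
  e_mul_self : ∀ x, P x * P x = P x
  e_mul_e : ∀ x y, x ≠ y → P x * P y = 0
  e_mul_s : ∀ a, P (Q.r a) * S a = S a
  s_mul_e : ∀ a, S a * P (Q.s a) = S a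
  t_mul_e : ∀ a, T a * P (Q.r a) = T a
  e_mul_t : ∀ a, P (Q.s a) * T a = T a
  t_mul_s_self : ∀ a, T a * S a = P (Q.s a)
  t_mul_s : ∀ a b, a ≠ b → T a * S b = 0
  ck2 : ∀ (x : Q.V) (h : {a | Q.r a = x}.Finite), {a | Q.r a = x}.Nonempty →
    P x = ∑ a ∈ h.toFinset, S a * T a

/-- The generators `s_a`, `t_a`, `e_v`. -/
inductive Gen (Q : DirGraph.{u}) : Type u
  | s (a : Q.E) : Gen Q
  | t (a : Q.E) : Gen Q
  | e (x : Q.V) : Gen Q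

section

variable (Q : DirGraph.{u})

/-- the free variable `s_a` -/
noncomputable abbrev freeS (a : Q.E) : FreeAlgebra ℂ Q.Gen := FreeAlgebra.ι ℂ (Gen.s a)
/-- the free variable `t_a` -/
noncomputable abbrev freeT (a : Q.E) : FreeAlgebra ℂ Q.Gen := FreeAlgebra.ι ℂ (Gen.t a)
/-- the free variable `e_v` -/
noncomputable abbrev freeE (x : Q.V) : FreeAlgebra ℂ Q.Gen := FreeAlgebra.ι ℂ (Gen.e x)

/-- The defining relations of the Leavitt path algebra. -/
inductive LeavittRel : FreeAlgebra ℂ Q.Gen → FreeAlgebra ℂ Q.Gen → Prop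
  | e_mul_self (x : Q.V) : LeavittRel (Q.freeE x * Q.freeE x) (Q.freeE x)
  | e_mul_e (x y : Q.V) (h : x ≠ y) : LeavittRel (Q.freeE x * Q.freeE y) 0
  | e_mul_s (a : Q.E) : LeavittRel (Q.freeE (Q.r a) * Q.freeS a) (Q.freeS a)
  | s_mul_e (a : Q.E) : LeavittRel (Q.freeS a * Q.freeE (Q.s a)) (Q.freeS a)
  | t_mul_e (a : Q.E) : LeavittRel (Q.freeT a * Q.freeE (Q.r a)) (Q.freeT a)
  | e_mul_t (a : Q.E) : LeavittRel (Q.freeE (Q.s a) * Q.freeT a) (Q.freeT a)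
  | t_mul_s_self (a : Q.E) : LeavittRel (Q.freeT a * Q.freeS a) (Q.freeE (Q.s a))
  | t_mul_s (a b : Q.E) (h : a ≠ b) : LeavittRel (Q.freeT a * Q.freeS b) 0
  | ck2 (x : Q.V) (h : {a | Q.r a = x}.Finite) (hne : {a | Q.r a = x}.Nonempty) :
      LeavittRel (Q.freeE x) (∑ a ∈ h.toFinset, Q.freeS a * Q.freeT a)

/-- The universal *unital* complex algebra on the generators and relations. -/
abbrev UnitalLeavitt : Type u := RingQuot Q.LeavittRel

/-- the image of a generator in the universal unital algebra -/
noncomputable def unitalGen (g : Q.Gen) : Q.UnitalLeavitt :=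
  RingQuot.mkAlgHom ℂ Q.LeavittRel (FreeAlgebra.ι ℂ g)

/-- The Leavitt path algebra `L_Q`: the universal (not necessarily unital) complex algebra on
generators `s_a`, `t_a`, `e_v` subject to the relations of `IsLeavittFamily`. It is realised as
the non-unital subalgebra generated by the generators inside the universal unital algebra; its
universal property is proved in `leavittLift`, `leavittLift_s`, `leavittLift_t`, `leavittLift_e`
and `leavitt_hom_ext` below. -/
noncomputable abbrev Leavitt : NonUnitalSubalgebra ℂ Q.UnitalLeavitt :=
  NonUnitalAlgebra.adjoin ℂ (Set.range Q.unitalGen)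

/-- a generator of `L_Q` -/
noncomputable def leavittGen (g : Q.Gen) : Q.Leavitt :=
  ⟨Q.unitalGen g, NonUnitalAlgebra.subset_adjoin ℂ ⟨g, rfl⟩⟩

/-- the generator `s_a` of `L_Q` -/
noncomputable abbrev leavittS (a : Q.E) : Q.Leavitt := Q.leavittGen (Gen.s a)
/-- the generator `t_a` of `L_Q` -/
noncomputable abbrev leavittT (a : Q.E) : Q.Leavitt := Q.leavittGen (Gen.t a)
/-- the generator `e_v` of `L_Q` -/
noncomputable abbrev leavittE (x : Q.V) : Q.Leavitt := Q.leavittGen (Gen.e x)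

theorem isLeavittFamily_leavitt : Q.IsLeavittFamily Q.leavittS Q.leavittT Q.leavittE := by
  have key : ∀ {x y}, Q.LeavittRel x y →
      RingQuot.mkAlgHom ℂ Q.LeavittRel x = RingQuot.mkAlgHom ℂ Q.LeavittRel y :=
    fun h => RingQuot.mkAlgHom_rel ℂ h
  constructor
  · intro x
    exact Subtype.ext (by simpa [leavittGen, unitalGen] using key (.e_mul_self x))
  · intro x y h
    exact Subtype.ext (by simpa [leavittGen, unitalGen] using key (.e_mul_e x y h))
  · intro a
    exact Subtype.ext (by simpa [leavittGen, unitalGen] using key (.e_mul_s a))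
  · intro a
    exact Subtype.ext (by simpa [leavittGen, unitalGen] using key (.s_mul_e a))
  · intro a
    exact Subtype.ext (by simpa [leavittGen, unitalGen] using key (.t_mul_e a))
  · intro a
    exact Subtype.ext (by simpa [leavittGen, unitalGen] using key (.e_mul_t a))
  · intro a
    exact Subtype.ext (by simpa [leavittGen, unitalGen] using key (.t_mul_s_self a))
  · intro a b h
    exact Subtype.ext (by simpa [leavittGen, unitalGen] using key (.t_mul_s a b h))
  · intro x h hne
    exact Subtype.ext (by simpa [leavittGen, unitalGen] using key (.ck2 x h hne))

variable {Q}

theorem leavitt_induction {p : Q.Leavitt → Prop} (gen : ∀ g, p (Q.leavittGen g))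
    (add : ∀ x y, p x → p y → p (x + y)) (zero : p 0) (mul : ∀ x y, p x → p y → p (x * y))
    (smul : ∀ (c : ℂ) x, p x → p (c • x)) (x : Q.Leavitt) : p x := by
  obtain ⟨x, hx⟩ := x
  induction hx using NonUnitalAlgebra.adjoin_induction with
  | mem x hx => obtain ⟨g, rfl⟩ := hx; exact gen g
  | add x y hx hy h h' => exact add _ _ h h'
  | zero => exact zero
  | mul x y hx hy h h' => exact mul _ _ h h'
  | smul c x hx h => exact smul c _ h

variable {B : Type v} [NonUnitalRing B] [Module ℂ B]

theorem leavitt_hom_ext {f g : Q.Leavitt →ₙₐ[ℂ] B}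
    (hs : ∀ a, f (Q.leavittS a) = g (Q.leavittS a))
    (ht : ∀ a, f (Q.leavittT a) = g (Q.leavittT a))
    (he : ∀ x, f (Q.leavittE x) = g (Q.leavittE x)) : f = g := by
  refine NonUnitalAlgHom.ext fun x => ?_
  induction x using leavitt_induction with
  | gen k => cases k with
    | s a => exact hs a
    | t a => exact ht a
    | e x => exact he x
  | add x y h h' => rw [map_add, map_add, h, h']
  | zero => rw [map_zero, map_zero]
  | mul x y h h' => rw [map_mul, map_mul, h, h']
  | smul c x h => rw [map_smul, map_smul, h]

/-- the assignment of elements of `B` to generators -/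
def genMap (S T : Q.E → B) (P : Q.V → B) : Q.Gen → B
  | .s a => S a
  | .t a => T a
  | .e x => P x

variable [IsScalarTower ℂ B B] [SMulCommClass ℂ B B]

/-- auxiliary: the unital extension of `leavittLift` -/
noncomputable def unitalLift {S T : Q.E → B} {P : Q.V → B} (h : Q.IsLeavittFamily S T P) :
    Q.UnitalLeavitt →ₐ[ℂ] Unitization ℂ B :=
  RingQuot.liftAlgHom ℂ
    ⟨FreeAlgebra.lift ℂ (fun g => (Unitization.inr (genMap S T P g) : Unitization ℂ B)), by
      intro x y hxy
      cases hxy with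
      | e_mul_self x => simp [genMap, ← Unitization.inr_mul, h.e_mul_self]
      | e_mul_e x y hne => simp [genMap, ← Unitization.inr_mul, h.e_mul_e x y hne]
      | e_mul_s a => simp [genMap, ← Unitization.inr_mul, h.e_mul_s]
      | s_mul_e a => simp [genMap, ← Unitization.inr_mul, h.s_mul_e]
      | t_mul_e a => simp [genMap, ← Unitization.inr_mul, h.t_mul_e]
      | e_mul_t a => simp [genMap, ← Unitization.inr_mul, h.e_mul_t]
      | t_mul_s_self a => simp [genMap, ← Unitization.inr_mul, h.t_mul_s_self]
      | t_mul_s a b hne => simp [genMap, ← Unitization.inr_mul, h.t_mul_s a b hne]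
      | ck2 x hf hne =>
        simp only [map_sum, map_mul, FreeAlgebra.lift_ι_apply, genMap, h.ck2 x hf hne,
          ← Unitization.inr_mul]
        exact map_sum (Unitization.inrNonUnitalAlgHom ℂ B) _ _⟩

theorem unitalLift_gen {S T : Q.E → B} {P : Q.V → B} (h : Q.IsLeavittFamily S T P) (g : Q.Gen) :
    unitalLift h (Q.leavittGen g : Q.Leavitt) = Unitization.inr (genMap S T P g) := by
  simp [unitalLift, leavittGen, unitalGen]

theorem unitalLift_fst {S T : Q.E → B} {P : Q.V → B} (h : Q.IsLeavittFamily S T P)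
    (x : Q.Leavitt) : (unitalLift h x).fst = 0 := by
  induction x using leavitt_induction with
  | gen g => rw [unitalLift_gen]; simp
  | add x y h h' => simp [h, h']
  | zero => simp
  | mul x y h h' => simp [h, h']
  | smul c x h => simp [h]

/-- Universal property of `L_Q`: existence. -/
noncomputable def leavittLift {S T : Q.E → B} {P : Q.V → B} (h : Q.IsLeavittFamily S T P) :
    Q.Leavitt →ₙₐ[ℂ] B where
  toFun x := (unitalLift h x).snd
  map_smul' c x := by simp
  map_zero' := by simp
  map_add' x y := by simp
  map_mul' x y := by simp [unitalLift_fst h]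

@[simp]
theorem leavittLift_gen {S T : Q.E → B} {P : Q.V → B} (h : Q.IsLeavittFamily S T P) (g : Q.Gen) :
    leavittLift h (Q.leavittGen g) = genMap S T P g := by
  change (unitalLift h (Q.leavittGen g : Q.Leavitt)).snd = _
  rw [unitalLift_gen, Unitization.snd_inr]

theorem leavittLift_s {S T : Q.E → B} {P : Q.V → B} (h : Q.IsLeavittFamily S T P) (a : Q.E) :
    leavittLift h (Q.leavittS a) = S a := leavittLift_gen h _

theorem leavittLift_t {S T : Q.E → B} {P : Q.V → B} (h : Q.IsLeavittFamily S T P) (a : Q.E) :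
    leavittLift h (Q.leavittT a) = T a := leavittLift_gen h _

theorem leavittLift_e {S T : Q.E → B} {P : Q.V → B} (h : Q.IsLeavittFamily S T P) (x : Q.V) :
    leavittLift h (Q.leavittE x) = P x := leavittLift_gen h _

end

/-- Restriction of a Leavitt family along the inclusion of a Cuntz–Krieger subgraph. -/
theorem IsLeavittFamily.restrict {G H : DirGraph.{u}} (i : CKEmbedding G H) {A : Type v}
    [NonUnitalRing A] {S T : H.E → A} {P : H.V → A} (h : H.IsLeavittFamily S T P) :
    G.IsLeavittFamily (fun a => S (i.onE a)) (fun a => T (i.onE a)) (fun x => P (i.onV x)) where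
  e_mul_self x := h.e_mul_self _
  e_mul_e x y hne := h.e_mul_e _ _ (i.onV_injective.ne hne)
  e_mul_s a := by rw [← i.r_onE]; exact h.e_mul_s _
  s_mul_e a := by rw [← i.s_onE]; exact h.s_mul_e _
  t_mul_e a := by rw [← i.r_onE]; exact h.t_mul_e _
  e_mul_t a := by rw [← i.s_onE]; exact h.e_mul_t _
  t_mul_s_self a := by rw [← i.s_onE]; exact h.t_mul_s_self _
  t_mul_s a b hne := h.t_mul_s _ _ (i.onE_injective.ne hne)
  ck2 x hf hne := by
    have himg : {b | H.r b = i.onV x} = i.onE '' {a | G.r a = x} := by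
      ext b
      constructor
      · intro hb
        obtain ⟨a, rfl⟩ := i.isCuntzKrieger x hne hf b hb
        exact ⟨a, i.onV_injective ((i.r_onE a).symm.trans hb), rfl⟩
      · rintro ⟨a, ha, rfl⟩
        exact (i.r_onE a).trans (congrArg i.onV ha)
    have hf' : {b | H.r b = i.onV x}.Finite := himg ▸ hf.image _
    rw [h.ck2 (i.onV x) hf' (himg ▸ hne.image _)]
    have : hf'.toFinset = hf.toFinset.map ⟨i.onE, i.onE_injective⟩ := by
      ext b
      have := Set.ext_iff.mp himg b
      simpa using this
    rw [this, Finset.sum_map]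
    rfl

/-- The canonical homomorphism `L_R → L_Q` for a Cuntz–Krieger subgraph `R` of `Q`, sending each
generator to the generator of the same name. -/
noncomputable def leavittMap {G H : DirGraph.{u}} (i : CKEmbedding G H) :
    G.Leavitt →ₙₐ[ℂ] H.Leavitt :=
  leavittLift (H.isLeavittFamily_leavitt.restrict i)

/-! ### Cuntz–Krieger families, representations, and the norm of `𝒪ᵖ(Q)` -/

/-- An element `a` of a unital complex Banach algebra is hermitian if `‖exp(iλa)‖ ≤ 1` for all
real `λ`. -/
def IsHermitianElt {A : Type v} [NormedRing A] [NormedAlgebra ℂ A] (a : A) : Prop :=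
  ∀ c : ℝ, ‖NormedSpace.exp ((Complex.I * (c : ℂ)) • a)‖ ≤ 1

/-- A hermitian idempotent. -/
def IsHermitianIdem {A : Type v} [NormedRing A] [NormedAlgebra ℂ A] (a : A) : Prop :=
  IsIdempotentElem a ∧ IsHermitianElt a

/-- A Cuntz–Krieger `Q`-family in a unital Banach algebra. -/
structure IsCKFamily (Q : DirGraph.{u}) {A : Type v} [NormedRing A] [NormedAlgebra ℂ A]
    (S T : Q.E → A) (P : Q.V → A) : Prop where
  e_hermitian : ∀ x, IsHermitianIdem (P x)
  e_orthogonal : ∀ x y, x ≠ y → P x * P y = 0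
  norm_s_le : ∀ a, ‖S a‖ ≤ 1
  norm_t_le : ∀ a, ‖T a‖ ≤ 1
  sts : ∀ a, S a * T a * S a = S a
  tst : ∀ a, T a * S a * T a = T a
  st_hermitian : ∀ a, IsHermitianIdem (S a * T a)
  ts_hermitian : ∀ a, IsHermitianIdem (T a * S a)
  e_mul_s : ∀ a, P (Q.r a) * S a = S a
  s_mul_e : ∀ a, S a * P (Q.s a) = S a
  t_mul_e : ∀ a, T a * P (Q.r a) = T a
  e_mul_t : ∀ a, P (Q.s a) * T a = T a
  t_mul_s_self : ∀ a, T a * S a = P (Q.s a)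
  t_mul_s : ∀ a b, a ≠ b → T a * S b = 0
  ck2 : ∀ (x : Q.V) (h : {a | Q.r a = x}.Finite), {a | Q.r a = x}.Nonempty →
    P x = ∑ a ∈ h.toFinset, S a * T a

/-- A homomorphism from `L_Q` to a unital Banach algebra is a representation if it sends the
generators to a Cuntz–Krieger `Q`-family. -/
def IsRepresentation {Q : DirGraph.{u}} {A : Type v} [NormedRing A] [NormedAlgebra ℂ A]
    (φ : Q.Leavitt →ₙₐ[ℂ] A) : Prop :=
  Q.IsCKFamily (fun a => φ (Q.leavittS a)) (fun a => φ (Q.leavittT a)) (fun x => φ (Q.leavittE x))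

section Norm

variable (p : ℝ≥0∞) [Fact (1 ≤ p)]

/-- The Banach algebra of bounded operators on `Lᵖ(μ)`. -/
abbrev LpOp {X : Type u} [MeasurableSpace X] (μ : Measure X) : Type u :=
  Lp ℂ p μ →L[ℂ] Lp ℂ p μ

variable {Q : DirGraph.{u}}

/-- The set of the numbers `‖φ x‖`, where `φ` is a representation of `L_Q` on an `Lᵖ`-space. -/
def repNorms (x : Q.Leavitt) : Set ℝ :=
  {c | ∃ (X : Type u) (_ : MeasurableSpace X) (μ : Measure X) (φ : Q.Leavitt →ₙₐ[ℂ] LpOp p μ),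
    IsRepresentation φ ∧ ‖φ x‖ = c}

/-- The norm `‖x‖ = sup {‖φ x‖ : φ a representation of L_Q on an Lᵖ-space}` of `𝒪ᵖ(Q)`. -/
noncomputable def graphNorm (x : Q.Leavitt) : ℝ := sSup (repNorms p x)

theorem isHermitianElt_zero {A : Type v} [NormedRing A] [NormedAlgebra ℂ A] (h : ‖(1 : A)‖ ≤ 1) :
    IsHermitianElt (0 : A) := by
  intro c
  simpa using h

theorem IsHermitianIdem.norm_le {A : Type v} [NormedRing A] [NormedAlgebra ℂ A] [CompleteSpace A]
    {a : A} (h : IsHermitianIdem a) : ‖a‖ ≤ 1 := by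
  have h1 : ‖(1 : A)‖ ≤ 1 := by simpa using h.2 0
  have hexp : NormedSpace.exp ((Complex.I * (Real.pi : ℂ)) • a) = 1 - (2 : ℂ) • a := by
    have hs := NormedSpace.exp_series_hasSum_exp' (𝕂 := ℂ) ((Complex.I * (Real.pi : ℂ)) • a)
    have hz := (NormedSpace.exp_series_hasSum_exp' (𝕂 := ℂ) (Complex.I * (Real.pi : ℂ))).smul_const a
    have h0 : HasSum (fun n : ℕ => if n = 0 then (1 - a) else 0) (1 - a) := hasSum_ite_eq 0 _
    have hsum := hz.add h0
    have hfun : (fun n : ℕ => ((n.factorial : ℂ)⁻¹ • (Complex.I * (Real.pi : ℂ)) ^ n) • a +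
        if n = 0 then (1 - a) else 0) =
        fun n : ℕ => (n.factorial : ℂ)⁻¹ • ((Complex.I * (Real.pi : ℂ)) • a) ^ n := by
      funext n
      rcases n with _ | n
      · simp
      · rw [smul_pow, h.1.pow_succ_eq]
        simp [smul_smul]
    rw [hfun] at hsum
    rw [hs.unique hsum, ← Complex.exp_eq_exp_ℂ, mul_comm, Complex.exp_pi_mul_I]
    module
  have h2 : ‖1 - (2 : ℂ) • a‖ ≤ 1 := hexp ▸ h.2 Real.pi
  have h3 : ‖(2 : ℂ) • a‖ ≤ 2 := by
    calc ‖(2 : ℂ) • a‖ = ‖1 - (1 - (2 : ℂ) • a)‖ := by rw [sub_sub_cancel]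
      _ ≤ ‖(1 : A)‖ + ‖1 - (2 : ℂ) • a‖ := norm_sub_le _ _
      _ ≤ 2 := by linarith
  rw [norm_smul] at h3
  norm_num at h3
  linarith

theorem repNorms_bddAbove (x : Q.Leavitt) : BddAbove (repNorms p x) := by
  suffices h : ∃ C : ℝ, ∀ (X : Type u) (_ : MeasurableSpace X) (μ : Measure X)
      (φ : Q.Leavitt →ₙₐ[ℂ] LpOp p μ), IsRepresentation φ → ‖φ x‖ ≤ C by
    obtain ⟨C, hC⟩ := h
    refine ⟨C, ?_⟩
    rintro _ ⟨X, m, μ, φ, hφ, rfl⟩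
    exact hC X m μ φ hφ
  induction x using leavitt_induction with
  | gen g =>
    refine ⟨1, fun X m μ φ hφ => ?_⟩
    cases g with
    | s a => exact hφ.norm_s_le a
    | t a => exact hφ.norm_t_le a
    | e x => exact (hφ.e_hermitian x).norm_le
  | add x y h h' =>
    obtain ⟨C, hC⟩ := h
    obtain ⟨C', hC'⟩ := h'
    refine ⟨C + C', fun X m μ φ hφ => ?_⟩
    rw [map_add]
    exact (norm_add_le _ _).trans (add_le_add (hC X m μ φ hφ) (hC' X m μ φ hφ))
  | zero => exact ⟨0, fun X m μ φ hφ => by simp⟩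
  | mul x y h h' =>
    obtain ⟨C, hC⟩ := h
    obtain ⟨C', hC'⟩ := h'
    refine ⟨C * C', fun X m μ φ hφ => ?_⟩
    rw [map_mul]
    exact (norm_mul_le _ _).trans (mul_le_mul (hC X m μ φ hφ) (hC' X m μ φ hφ) (norm_nonneg _)
      ((norm_nonneg _).trans (hC X m μ φ hφ)))
  | smul c x h =>
    obtain ⟨C, hC⟩ := h
    refine ⟨‖c‖ * C, fun X m μ φ hφ => ?_⟩
    rw [map_smul, norm_smul]
    exact mul_le_mul_of_nonneg_left (hC X m μ φ hφ) (norm_nonneg _)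

theorem isRepresentation_zero {X : Type u} [MeasurableSpace X] (μ : Measure X) :
    IsRepresentation (0 : Q.Leavitt →ₙₐ[ℂ] LpOp p μ) := by
  have hz : IsHermitianIdem (0 : LpOp p μ) :=
    ⟨IsIdempotentElem.zero, isHermitianElt_zero ContinuousLinearMap.norm_id_le⟩
  constructor <;> intros <;> simp [hz]

theorem repNorms_nonempty (x : Q.Leavitt) : (repNorms p x).Nonempty :=
  ⟨_, PUnit, ⊤, 0, 0, isRepresentation_zero p _, rfl⟩

theorem norm_le_graphNorm {X : Type u} [MeasurableSpace X] {μ : Measure X}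
    {φ : Q.Leavitt →ₙₐ[ℂ] LpOp p μ} (hφ : IsRepresentation φ) (x : Q.Leavitt) :
    ‖φ x‖ ≤ graphNorm p x :=
  le_csSup (repNorms_bddAbove p x) ⟨X, _, μ, φ, hφ, rfl⟩

theorem graphNorm_le {x : Q.Leavitt} {C : ℝ}
    (h : ∀ (X : Type u) (_ : MeasurableSpace X) (μ : Measure X) (φ : Q.Leavitt →ₙₐ[ℂ] LpOp p μ),
      IsRepresentation φ → ‖φ x‖ ≤ C) : graphNorm p x ≤ C := by
  refine csSup_le (repNorms_nonempty p x) ?_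
  rintro _ ⟨X, m, μ, φ, hφ, rfl⟩
  exact h X m μ φ hφ

theorem graphNorm_nonneg (x : Q.Leavitt) : 0 ≤ graphNorm p x :=
  (norm_nonneg _).trans (norm_le_graphNorm p (isRepresentation_zero p (0 : @Measure PUnit ⊤)) x)

variable (Q) in
/-- `graphNorm` as a seminorm -/
noncomputable def graphSeminorm : AddGroupSeminorm Q.Leavitt where
  toFun := graphNorm p
  map_zero' := le_antisymm (graphNorm_le p fun X m μ φ _ => by simp) (graphNorm_nonneg p _)
  add_le' x y := graphNorm_le p fun X m μ φ hφ => by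
    rw [map_add]
    exact (norm_add_le _ _).trans (add_le_add (norm_le_graphNorm p hφ x) (norm_le_graphNorm p hφ y))
  neg' x := by
    refine le_antisymm (graphNorm_le p fun X m μ φ hφ => ?_) (graphNorm_le p fun X m μ φ hφ => ?_)
    · rw [map_neg, norm_neg]
      exact norm_le_graphNorm p hφ x
    · rw [← norm_neg, ← map_neg]
      exact norm_le_graphNorm p hφ (-x)

variable (Q) in
/-- The Leavitt path algebra, equipped with the norm `graphNorm p`. -/
def LeavittLp (_p : ℝ≥0∞) : Type u := Q.Leavitt

end Norm

section Completion

variable (p : ℝ≥0∞) [Fact (1 ≤ p)] (Q : DirGraph.{u})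

noncomputable instance : NonUnitalRing (Q.LeavittLp p) := inferInstanceAs (NonUnitalRing Q.Leavitt)
noncomputable instance : Module ℂ (Q.LeavittLp p) := inferInstanceAs (Module ℂ Q.Leavitt)
instance : IsScalarTower ℂ (Q.LeavittLp p) (Q.LeavittLp p) :=
  inferInstanceAs (IsScalarTower ℂ Q.Leavitt Q.Leavitt)
instance : SMulCommClass ℂ (Q.LeavittLp p) (Q.LeavittLp p) :=
  inferInstanceAs (SMulCommClass ℂ Q.Leavitt Q.Leavitt)

noncomputable instance : NonUnitalSeminormedRing (Q.LeavittLp p) where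
  __ := (inferInstance : NonUnitalRing (Q.LeavittLp p))
  __ := (Q.graphSeminorm p).toSeminormedAddCommGroup
  norm_mul_le x y := graphNorm_le (Q := Q) p fun X m μ φ hφ => by
    refine (congrArg norm (map_mul φ x y)).trans_le ((norm_mul_le _ _).trans ?_)
    exact mul_le_mul (norm_le_graphNorm p hφ x) (norm_le_graphNorm p hφ y) (norm_nonneg _)
      (graphNorm_nonneg p _)

variable {Q} in
/-- the identity map from `L_Q` to the normed algebra `L_Q` -/
def LeavittLp.of (x : Q.Leavitt) : Q.LeavittLp p := x

theorem LeavittLp.norm_def (x : Q.LeavittLp p) : ‖x‖ = graphNorm (Q := Q) p x := rfl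

noncomputable instance : NormedSpace ℂ (Q.LeavittLp p) where
  norm_smul_le c x := graphNorm_le (Q := Q) p fun X m μ φ hφ => by
    refine (congrArg norm (map_smul φ c x)).trans_le ?_
    rw [norm_smul]
    exact mul_le_mul_of_nonneg_left (norm_le_graphNorm p hφ x) (norm_nonneg _)

/-- The `Lᵖ`-operator graph algebra `𝒪ᵖ(Q)`: the completion of `L_Q` in the norm `graphNorm p`. -/
abbrev GraphAlgebra : Type u := UniformSpace.Completion (Q.LeavittLp p)

open UniformSpace Completion in
/-- The multiplication of `𝒪ᵖ(Q)` is the continuous extension of the multiplication of `L_Q`. -/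
noncomputable instance : Mul (Q.GraphAlgebra p) :=
  ⟨Function.curry <| (isDenseInducing_coe.prodMap isDenseInducing_coe).extend
    ((fun x : Q.LeavittLp p => (x : Q.GraphAlgebra p)) ∘
      Function.uncurry (fun x y : Q.LeavittLp p => x * y))⟩

namespace GraphAlgebra

open UniformSpace Completion

theorem coe_mul (a b : Q.LeavittLp p) :
    ((a * b : Q.LeavittLp p) : Q.GraphAlgebra p) = (a : Q.GraphAlgebra p) * b :=
  ((isDenseInducing_coe.prodMap isDenseInducing_coe).extend_eq
    ((continuous_coe (Q.LeavittLp p)).comp continuous_mul) (a, b)).symm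

instance : ContinuousMul (Q.GraphAlgebra p) where
  continuous_mul := by
    let m := (AddMonoidHom.mul : Q.LeavittLp p →+ Q.LeavittLp p →+ Q.LeavittLp p).compr₂ toCompl
    have : Continuous fun q : Q.LeavittLp p × Q.LeavittLp p => m q.1 q.2 :=
      (continuous_coe _).comp continuous_mul
    have di : IsDenseInducing (toCompl : Q.LeavittLp p → Q.GraphAlgebra p) := isDenseInducing_coe
    exact (di.extend_Z_bilin di this :)

noncomputable instance : NonUnitalNormedRing (Q.GraphAlgebra p) where
  __ := (inferInstance : NormedAddCommGroup (Q.GraphAlgebra p))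
  mul := (· * ·)
  zero_mul a := Completion.induction_on a (isClosed_eq (by fun_prop) continuous_const)
    fun a => by rw [← coe_zero, ← coe_mul, zero_mul]
  mul_zero a := Completion.induction_on a (isClosed_eq (by fun_prop) continuous_const)
    fun a => by rw [← coe_zero, ← coe_mul, mul_zero]
  mul_assoc a b c := Completion.induction_on₃ a b c (isClosed_eq (by fun_prop) (by fun_prop))
    fun a b c => by rw [← coe_mul, ← coe_mul, ← coe_mul, ← coe_mul, mul_assoc]
  left_distrib a b c := Completion.induction_on₃ a b c (isClosed_eq (by fun_prop) (by fun_prop))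
    fun a b c => by rw [← coe_add, ← coe_mul, ← coe_mul, ← coe_mul, ← coe_add, mul_add]
  right_distrib a b c := Completion.induction_on₃ a b c (isClosed_eq (by fun_prop) (by fun_prop))
    fun a b c => by rw [← coe_add, ← coe_mul, ← coe_mul, ← coe_mul, ← coe_add, add_mul]
  norm_mul_le a b := Completion.induction_on₂ a b (isClosed_le (by fun_prop) (by fun_prop))
    fun a b => by rw [← coe_mul, norm_coe, norm_coe, norm_coe]; exact norm_mul_le a b

instance : IsScalarTower ℂ (Q.GraphAlgebra p) (Q.GraphAlgebra p) where
  smul_assoc c x y := by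
    refine Completion.induction_on₂ x y (isClosed_eq ?_ ?_) fun x y => ?_
    · exact (continuous_fst.const_smul c).mul continuous_snd
    · exact (continuous_fst.mul continuous_snd).const_smul c
    · rw [smul_eq_mul, smul_eq_mul, ← coe_smul, ← coe_mul, ← coe_mul, ← coe_smul, smul_mul_assoc]

instance : SMulCommClass ℂ (Q.GraphAlgebra p) (Q.GraphAlgebra p) where
  smul_comm c x y := by
    refine Completion.induction_on₂ x y (isClosed_eq ?_ ?_) fun x y => ?_
    · exact (continuous_fst.mul continuous_snd).const_smul c
    · exact continuous_fst.mul (continuous_snd.const_smul c)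
    · rw [smul_eq_mul, smul_eq_mul, ← coe_smul, ← coe_mul, ← coe_mul, ← coe_smul, mul_smul_comm]

variable {Q}

/-- The canonical homomorphism `L_Q → 𝒪ᵖ(Q)`. -/
noncomputable def ofLeavitt : Q.Leavitt →ₙₐ[ℂ] Q.GraphAlgebra p where
  toFun x := (LeavittLp.of p x : Q.GraphAlgebra p)
  map_smul' c x := coe_smul c (LeavittLp.of p x)
  map_zero' := coe_zero
  map_add' x y := coe_add (LeavittLp.of p x) (LeavittLp.of p y)
  map_mul' x y := coe_mul p Q (LeavittLp.of p x) (LeavittLp.of p y)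

theorem norm_ofLeavitt (x : Q.Leavitt) : ‖ofLeavitt p x‖ = graphNorm p x :=
  norm_coe (LeavittLp.of p x)

theorem denseRange_ofLeavitt : DenseRange (ofLeavitt p : Q.Leavitt → Q.GraphAlgebra p) :=
  denseRange_coe (α := Q.LeavittLp p)

end GraphAlgebra

variable {Q}

/-- Restricting a representation to a Cuntz–Krieger subgraph gives a representation. -/
theorem IsRepresentation.restrict {G H : DirGraph.{u}} (i : CKEmbedding G H) {A : Type v}
    [NormedRing A] [NormedAlgebra ℂ A] {φ : H.Leavitt →ₙₐ[ℂ] A} (h : IsRepresentation φ) :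
    IsRepresentation (φ.comp (leavittMap i)) := by
  have hs : ∀ a, (φ.comp (leavittMap i)) (G.leavittS a) = φ (H.leavittS (i.onE a)) :=
    fun a => congrArg φ (leavittLift_s _ a)
  have ht : ∀ a, (φ.comp (leavittMap i)) (G.leavittT a) = φ (H.leavittT (i.onE a)) :=
    fun a => congrArg φ (leavittLift_t _ a)
  have he : ∀ x, (φ.comp (leavittMap i)) (G.leavittE x) = φ (H.leavittE (i.onV x)) :=
    fun x => congrArg φ (leavittLift_e _ x)
  have hL : H.IsLeavittFamily (fun a => φ (H.leavittS a)) (fun a => φ (H.leavittT a))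
      (fun x => φ (H.leavittE x)) :=
    ⟨fun x => (h.e_hermitian x).1, h.e_orthogonal, h.e_mul_s, h.s_mul_e, h.t_mul_e, h.e_mul_t,
      h.t_mul_s_self, h.t_mul_s, h.ck2⟩
  have hL' := hL.restrict i
  unfold IsRepresentation
  simp only [hs, ht, he]
  exact ⟨fun x => h.e_hermitian _, hL'.e_mul_e, fun a => h.norm_s_le _, fun a => h.norm_t_le _,
    fun a => h.sts _, fun a => h.tst _, fun a => h.st_hermitian _, fun a => h.ts_hermitian _,
    hL'.e_mul_s, hL'.s_mul_e, hL'.t_mul_e, hL'.e_mul_t, hL'.t_mul_s_self, hL'.t_mul_s, hL'.ck2⟩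

theorem graphNorm_leavittMap_le {G H : DirGraph.{u}} (i : CKEmbedding G H) (x : G.Leavitt) :
    graphNorm p (leavittMap i x) ≤ graphNorm p x :=
  graphNorm_le p fun _ _ _ _ hφ => norm_le_graphNorm p (hφ.restrict i) x

/-- `L_R → L_Q` as a map between normed algebras, continuous and additive. -/
noncomputable def leavittMapLp {G H : DirGraph.{u}} (i : CKEmbedding G H) :
    G.LeavittLp p →ₙₐ[ℂ] H.LeavittLp p := leavittMap i

theorem uniformContinuous_leavittMapLp {G H : DirGraph.{u}} (i : CKEmbedding G H) :
    UniformContinuous (leavittMapLp p i) :=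
  (AddMonoidHomClass.lipschitz_of_bound (leavittMapLp p i) 1 fun x => by
    rw [one_mul]; exact graphNorm_leavittMap_le p i x).uniformContinuous

open UniformSpace Completion in
/-- The homomorphism `𝒪ᵖ(R) → 𝒪ᵖ(Q)` extending the canonical homomorphism `L_R → L_Q` by
continuity, for a Cuntz–Krieger subgraph `R` of `Q`. -/
noncomputable def graphAlgebraMap {G H : DirGraph.{u}} (i : CKEmbedding G H) :
    G.GraphAlgebra p →ₙₐ[ℂ] H.GraphAlgebra p where
  toFun := Completion.map (leavittMapLp p i)
  map_smul' c x := by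
    refine Completion.induction_on x (isClosed_eq ?_ ?_) fun x => ?_
    · exact continuous_map.comp (continuous_const_smul c)
    · exact Continuous.const_smul (continuous_map (f := leavittMapLp p i)) c
    · rw [← coe_smul, map_coe (uniformContinuous_leavittMapLp p i),
        map_coe (uniformContinuous_leavittMapLp p i), map_smul, coe_smul]
      rfl
  map_zero' := by
    rw [← coe_zero, map_coe (uniformContinuous_leavittMapLp p i), map_zero, coe_zero]
  map_add' x y := by
    refine Completion.induction_on₂ x y (isClosed_eq ?_ ?_) fun x y => ?_
    · exact continuous_map.comp continuous_add
    · exact Continuous.add (continuous_map.comp continuous_fst)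
        (continuous_map.comp continuous_snd)
    · rw [← coe_add, map_coe (uniformContinuous_leavittMapLp p i),
        map_coe (uniformContinuous_leavittMapLp p i), map_coe (uniformContinuous_leavittMapLp p i),
        map_add, coe_add]
  map_mul' x y := by
    refine Completion.induction_on₂ x y (isClosed_eq ?_ ?_) fun x y => ?_
    · exact continuous_map.comp continuous_mul
    · exact (continuous_map.comp continuous_fst).mul (continuous_map.comp continuous_snd)
    · rw [← GraphAlgebra.coe_mul, map_coe (uniformContinuous_leavittMapLp p i),
        map_coe (uniformContinuous_leavittMapLp p i), map_coe (uniformContinuous_leavittMapLp p i),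
        map_mul, GraphAlgebra.coe_mul]

theorem graphAlgebraMap_ofLeavitt {G H : DirGraph.{u}} (i : CKEmbedding G H) (x : G.Leavitt) :
    graphAlgebraMap p i (GraphAlgebra.ofLeavitt p x) =
      GraphAlgebra.ofLeavitt p (leavittMap i x) :=
  UniformSpace.Completion.map_coe (uniformContinuous_leavittMapLp p i) (LeavittLp.of p x)

end Completion

end DirGraph

/-! ### Direct limits of Banach algebras -/

/-- `L` together with the maps `g i : A i → L` is the direct limit, in the category of complex
Banach algebras and isometric homomorphisms, of the directed system with algebras `A i` and
connecting maps `f`: the index set is directed and nonempty, the connecting maps are isometric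
and functorial, the `g i` are isometric and compatible with the connecting maps, and every
compatible family of isometric homomorphisms into a Banach algebra `B` factors uniquely through an
isometric homomorphism `L → B`. The last field says that `L` has the same universal property
for contractive homomorphisms. -/
structure IsIsometricDirectLimit {I : Type u} [Preorder I] (A : I → Type u)
    [∀ i, NonUnitalNormedRing (A i)] [∀ i, NormedSpace ℂ (A i)]
    [∀ i, IsScalarTower ℂ (A i) (A i)] [∀ i, SMulCommClass ℂ (A i) (A i)]
    [∀ i, CompleteSpace (A i)] (f : ∀ i j, i ≤ j → A i →ₙₐ[ℂ] A j)
    (L : Type u) [NonUnitalNormedRing L] [NormedSpace ℂ L] [IsScalarTower ℂ L L]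
    [SMulCommClass ℂ L L] [CompleteSpace L] (g : ∀ i, A i →ₙₐ[ℂ] L) : Prop where
  nonempty : Nonempty I
  directed : IsDirected I (· ≤ ·)
  map_self : ∀ i, f i i le_rfl = NonUnitalAlgHom.id ℂ (A i)
  map_comp : ∀ i j k (hij : i ≤ j) (hjk : j ≤ k),
    (f j k hjk).comp (f i j hij) = f i k (hij.trans hjk)
  isometry_map : ∀ i j (hij : i ≤ j), Isometry (f i j hij)
  isometry_ι : ∀ i, Isometry (g i)
  compatible : ∀ i j (hij : i ≤ j), (g j).comp (f i j hij) = g i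
  universal : ∀ (B : Type w) [NonUnitalNormedRing B] [NormedSpace ℂ B] [IsScalarTower ℂ B B]
    [SMulCommClass ℂ B B] [CompleteSpace B] (h : ∀ i, A i →ₙₐ[ℂ] B),
    (∀ i, Isometry (h i)) → (∀ i j (hij : i ≤ j), (h j).comp (f i j hij) = h i) →
      ∃! k : L →ₙₐ[ℂ] B, Isometry k ∧ ∀ i, k.comp (g i) = h i
  universal_contractive : ∀ (B : Type w) [NonUnitalNormedRing B] [NormedSpace ℂ B]
    [IsScalarTower ℂ B B] [SMulCommClass ℂ B B] [CompleteSpace B] (h : ∀ i, A i →ₙₐ[ℂ] B),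
    (∀ i x, ‖h i x‖ ≤ ‖x‖) → (∀ i j (hij : i ≤ j), (h j).comp (f i j hij) = h i) →
      ∃! k : L →ₙₐ[ℂ] B, (∀ x, ‖k x‖ ≤ ‖x‖) ∧ ∀ i, k.comp (g i) = h i

/-! ### Monomial operators on `ℓᵖ`-direct sums -/

section Monomial

variable {I : Type u} {E : Type v} [NormedAddCommGroup E] [NormedSpace ℂ E] {p : ℝ≥0∞}

/-! The canonical map `L_G → L_H` of a Cuntz–Krieger subgraph `G` of `H` is contractive because
representations of `L_H` restrict to `L_G`. The substance is the reverse inequality: every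
representation of `L_G` on `E = Lᵖ(μ)` sits, as an invariant subspace, in the restriction of a
representation of `L_H` on a larger `Lᵖ`-space (`IsRepresentation.exists_dilation`).

Extended by zero to `H` (`IsCKFamily.extend`), the given operators can violate only two relations:
`t_a s_a = e_{s(a)}` for edges `a` outside `G`, and the summation relation at vertices that receive
edges in `H` but none from `G`. Both are repaired by adding copies of `E`. At a vertex `x` of the
second kind, choose a backward path `a₀, a₁, …` from `x`. Then `S_{a₀}` carries the `P x`-part of
the copy `down x 0` onto the `P x`-part of the base, and `S_{a_{n+1}}` carries that of `down x
(n+1)` onto that of `down x n`. The path stops only at a vertex that receives no edges, so the new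
copies need no further repair. For the first relation, whenever `a` has no prescribed target for a
summand `y`, a free copy `up a y` receives the part of `y` over `s(a)`.

All operators so obtained are monomial: each row and column has at most one nonzero entry, which is
one of the original operators. On an `ℓᵖ`-sum such operators are contractions, and diagonal ones
with hermitian idempotent entries are hermitian idempotents. The `ℓᵖ`-sum of copies of `Lᵖ(μ)` is
the `Lᵖ`-space of a disjoint union (`lpSigmaEquiv`), so the dilation is admissible in the supremum
that defines the norm. This gives `graphNorm_leavittMap`.

For the direct limits, each vertex is given a countable set of incoming edges that is either
complete or infinite. Closing up under these sets puts any countable data into a countable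
Cuntz–Krieger subgraph and preserves entries of cycles. Hence the stages are directed, their
isometric images have dense union, and compatible homomorphisms extend by continuity
(`existsUnique_lift`). -/

theorem lpMonomial_sum_le [Fact (1 ≤ p)] (hp : p ≠ ∞) (σ : I → I) (W : I → E →L[ℂ] E)
    (hW : ∀ x, ‖W x‖ ≤ 1) (hσ : Set.InjOn σ {x | W x ≠ 0}) (f : lp (fun _ : I => E) p)
    (s : Finset I) : ∑ x ∈ s, ‖W x (f (σ x))‖ ^ p.toReal ≤ ‖f‖ ^ p.toReal := by
  classical
  have hp0 : 0 < p.toReal := ENNReal.toReal_pos (zero_lt_one.trans_le Fact.out).ne' hp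
  -- Indices of zero weight are discarded first, since `σ` may fail to be injective there.
  calc ∑ x ∈ s, ‖W x (f (σ x))‖ ^ p.toReal
      = ∑ x ∈ s with W x ≠ 0, ‖W x (f (σ x))‖ ^ p.toReal := by
        refine (Finset.sum_filter_of_ne (p := fun x => W x ≠ 0) fun x _ hx h0 => hx ?_).symm
        simp [h0, hp0.ne']
    _ ≤ ∑ x ∈ s with W x ≠ 0, ‖f (σ x)‖ ^ p.toReal := by
        refine Finset.sum_le_sum fun x _ => Real.rpow_le_rpow (norm_nonneg _) ?_ hp0.le
        simpa using (W x).le_of_opNorm_le (hW x) (f (σ x))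
    _ = ∑ y ∈ (s.filter fun x => W x ≠ 0).image σ, ‖f y‖ ^ p.toReal := by
        refine (Finset.sum_image (f := fun y => ‖f y‖ ^ p.toReal) fun x hx y hy h =>
          hσ (Finset.mem_filter.mp hx).2 (Finset.mem_filter.mp hy).2 h).symm
    _ ≤ ‖f‖ ^ p.toReal := lp.sum_rpow_le_norm_rpow hp0 f _

/-- The operator `(A f) x = W x (f (σ x))` on `ℓᵖ(I, E)`, for contractions `W x` and a map `σ`
which is injective on the support of `W`. -/
noncomputable def lpMonomial [Fact (1 ≤ p)] (hp : p ≠ ∞) (σ : I → I) (W : I → E →L[ℂ] E)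
    (hW : ∀ x, ‖W x‖ ≤ 1) (hσ : Set.InjOn σ {x | W x ≠ 0}) :
    lp (fun _ : I => E) p →L[ℂ] lp (fun _ : I => E) p :=
  LinearMap.mkContinuous
    { toFun := fun f => ⟨fun x => W x (f (σ x)), memℓp_gen' (lpMonomial_sum_le hp σ W hW hσ f)⟩
      map_add' := fun f g => lp.ext (funext fun x => (W x).map_add _ _)
      map_smul' := fun c f => lp.ext (funext fun x => (W x).map_smul c _) } 1 fun f => by
    rw [one_mul]
    exact lp.norm_le_of_forall_sum_le
      (ENNReal.toReal_pos (zero_lt_one.trans_le Fact.out).ne' hp) (norm_nonneg _)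
      (lpMonomial_sum_le hp σ W hW hσ f)

variable [Fact (1 ≤ p)] (hp : p ≠ ∞) (σ : I → I) (W : I → E →L[ℂ] E)
    (hW : ∀ x, ‖W x‖ ≤ 1) (hσ : Set.InjOn σ {x | W x ≠ 0})

theorem norm_lpMonomial_le : ‖lpMonomial hp σ W hW hσ‖ ≤ 1 :=
  LinearMap.mkContinuous_norm_le _ zero_le_one _

end Monomial

/-! ### Hermitian idempotents -/

section Hermitian

variable {A : Type v} [NormedRing A] [NormedAlgebra ℂ A]

namespace DirGraph

theorem isHermitianIdem_zero (h : ‖(1 : A)‖ ≤ 1) : IsHermitianIdem (0 : A) :=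
  ⟨IsIdempotentElem.zero, isHermitianElt_zero h⟩

theorem IsCKFamily.isLeavittFamily {Q : DirGraph.{u}} {S T : Q.E → A} {P : Q.V → A}
    (h : Q.IsCKFamily S T P) : Q.IsLeavittFamily S T P where
  e_mul_self x := (h.e_hermitian x).1
  e_mul_e := h.e_orthogonal
  e_mul_s := h.e_mul_s
  s_mul_e := h.s_mul_e
  t_mul_e := h.t_mul_e
  e_mul_t := h.e_mul_t
  t_mul_s_self := h.t_mul_s_self
  t_mul_s := h.t_mul_s
  ck2 := h.ck2

theorem IsCKFamily.isRepresentation {Q : DirGraph.{u}} {S T : Q.E → A} {P : Q.V → A}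
    (h : Q.IsCKFamily S T P) : IsRepresentation (leavittLift h.isLeavittFamily) := by
  unfold IsRepresentation
  simpa only [leavittLift_s, leavittLift_t, leavittLift_e] using h

end DirGraph

variable [CompleteSpace A]

/-- All powers of `z • a` of positive degree are multiples of `a`, so the series is the scalar
exponential series times `a`, corrected by `1 - a` in degree zero. -/
theorem IsIdempotentElem.exp_smul {a : A} (h : IsIdempotentElem a) (z : ℂ) :
    NormedSpace.exp (z • a) = 1 + (Complex.exp z - 1) • a := by
  have hs := NormedSpace.exp_series_hasSum_exp' (𝕂 := ℂ) (z • a)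
  have hz := (NormedSpace.exp_series_hasSum_exp' (𝕂 := ℂ) z).smul_const a
  have h0 : HasSum (fun n : ℕ => if n = 0 then (1 - a) else 0) (1 - a) := hasSum_ite_eq 0 _
  have hsum := hz.add h0
  have hfun : (fun n : ℕ => ((n.factorial : ℂ)⁻¹ • z ^ n) • a +
      if n = 0 then (1 - a) else 0) = fun n : ℕ => (n.factorial : ℂ)⁻¹ • (z • a) ^ n := by
    funext n
    rcases n with _ | n
    · simp
    · rw [smul_pow, h.pow_succ_eq]
      simp [smul_smul]
  rw [hfun] at hsum
  rw [hs.unique hsum, ← Complex.exp_eq_exp_ℂ]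
  module

namespace DirGraph

/-- This form replaces the exponential by an affine expression in `a`, which can be checked entry by
entry on diagonal operators and is preserved by unital homomorphisms. -/
theorem isHermitianIdem_iff {a : A} : IsHermitianIdem a ↔ IsIdempotentElem a ∧
    ∀ c : ℝ, ‖1 + (Complex.exp (Complex.I * (c : ℂ)) - 1) • a‖ ≤ 1 := by
  unfold IsHermitianIdem IsHermitianElt
  refine and_congr_right fun h => forall_congr' fun c => ?_
  rw [h.exp_smul]

theorem IsHermitianIdem.map {B : Type w} [NormedRing B] [NormedAlgebra ℂ B] [CompleteSpace B]
    {F : Type*} [FunLike F A B] [AlgHomClass F ℂ A B] (Φ : F) (hΦ : ∀ x, ‖Φ x‖ ≤ ‖x‖) {a : A}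
    (h : IsHermitianIdem a) : IsHermitianIdem (Φ a) := by
  rw [isHermitianIdem_iff] at h ⊢
  refine ⟨h.1.map Φ, fun c => ?_⟩
  have := (hΦ _).trans (h.2 c)
  rwa [map_add, map_one, map_smul] at this

theorem IsCKFamily.map {Q : DirGraph.{u}} {S T : Q.E → A} {P : Q.V → A} (h : Q.IsCKFamily S T P)
    {B : Type w} [NormedRing B] [NormedAlgebra ℂ B] [CompleteSpace B]
    {F : Type*} [FunLike F A B] [AlgHomClass F ℂ A B] (Φ : F) (hΦ : ∀ x, ‖Φ x‖ ≤ ‖x‖) :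
    Q.IsCKFamily (fun a => Φ (S a)) (fun a => Φ (T a)) (fun x => Φ (P x)) where
  e_hermitian x := (h.e_hermitian x).map Φ hΦ
  e_orthogonal x y hne := by rw [← map_mul, h.e_orthogonal x y hne, map_zero]
  norm_s_le a := (hΦ _).trans (h.norm_s_le a)
  norm_t_le a := (hΦ _).trans (h.norm_t_le a)
  sts a := by rw [← map_mul, ← map_mul, h.sts]
  tst a := by rw [← map_mul, ← map_mul, h.tst]
  st_hermitian a := by rw [← map_mul]; exact (h.st_hermitian a).map Φ hΦ
  ts_hermitian a := by rw [← map_mul]; exact (h.ts_hermitian a).map Φ hΦ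
  e_mul_s a := by rw [← map_mul, h.e_mul_s]
  s_mul_e a := by rw [← map_mul, h.s_mul_e]
  t_mul_e a := by rw [← map_mul, h.t_mul_e]
  e_mul_t a := by rw [← map_mul, h.e_mul_t]
  t_mul_s_self a := by rw [← map_mul, h.t_mul_s_self]
  t_mul_s a b hne := by rw [← map_mul, h.t_mul_s a b hne, map_zero]
  ck2 x hf hne := by simp only [← map_mul, ← map_sum]; rw [h.ck2 x hf hne]

end DirGraph

/-- Diagonal operators with hermitian idempotent entries are hermitian idempotents. -/
theorem DirGraph.isHermitianIdem_of_apply {I : Type u} {E : Type v} [NormedAddCommGroup E]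
    [NormedSpace ℂ E] [CompleteSpace E] {p : ℝ≥0∞} [Fact (1 ≤ p)] (hp : p ≠ ∞)
    (W : I → E →L[ℂ] E) (hW : ∀ x, IsHermitianIdem (W x))
    (A : lp (fun _ : I => E) p →L[ℂ] lp (fun _ : I => E) p)
    (hA : ∀ f x, A f x = W x (f x)) : IsHermitianIdem A := by
  simp only [isHermitianIdem_iff] at hW ⊢
  refine ⟨ContinuousLinearMap.ext fun f => lp.ext (funext fun x => ?_), fun c => ?_⟩
  · rw [mul_apply_eq_comp, hA, hA, ← mul_apply_eq_comp, (hW x).1]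
  -- The affine expression is again diagonal, with contractive entries, hence monomial with index
  -- map `id`.
  · have h : 1 + (Complex.exp (Complex.I * (c : ℂ)) - 1) • A =
        lpMonomial hp id _ (fun x : I => (hW x).2 c) (Set.injOn_id _) := by
      refine ContinuousLinearMap.ext fun f => lp.ext (funext fun x => ?_)
      change f x + (Complex.exp (Complex.I * (c : ℂ)) - 1) • A f x = _
      rw [hA]
      rfl
    rw [h]
    exact norm_lpMonomial_le _ _ _ _ _

end Hermitian

/-! ### `ℓᵖ`-direct sums of `Lᵖ`-spaces -/

section SigmaMeasure

variable {I : Type u} {X : Type v} [MeasurableSpace X]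

/-- The inclusion of a copy of `X` into a disjoint union of copies. -/
abbrev copyMk (i : I) (x : X) : Σ _ : I, X := ⟨i, x⟩

theorem measurableSet_sigma_iff {s : Set (Σ _ : I, X)} :
    MeasurableSet s ↔ ∀ i, MeasurableSet (copyMk i ⁻¹' s) := by
  change MeasurableSet[⨅ i, _] s ↔ _
  rw [MeasurableSpace.measurableSet_iInf]
  rfl

theorem measurable_copyMk (i : I) : Measurable (copyMk i : X → Σ _ : I, X) :=
  fun _ hs => measurableSet_sigma_iff.mp hs i

theorem measurable_sigma_iff {Y : Type w} [MeasurableSpace Y] {f : (Σ _ : I, X) → Y} :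
    Measurable f ↔ ∀ i, Measurable fun x => f ⟨i, x⟩ :=
  ⟨fun hf i => hf.comp (measurable_copyMk i),
    fun hf _ hs => measurableSet_sigma_iff.mpr fun i => hf i hs⟩

variable (I) in
/-- The disjoint union of copies of a measure. -/
noncomputable def sigmaMeasure (μ : Measure X) : Measure (Σ _ : I, X) :=
  Measure.sum fun i => μ.map (copyMk i)

variable {μ : Measure X}

theorem map_copyMk_le (i : I) : μ.map (copyMk i) ≤ sigmaMeasure I μ :=
  Measure.le_sum (fun i => μ.map (copyMk i)) i

/-- No countability of `I` is needed: measurability in the disjoint union is tested copy by copy, so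
the null sets can be enlarged to measurable ones separately, and a sum of zeros over any index set
is zero. -/
theorem ae_sigmaMeasure_iff {q : (Σ _ : I, X) → Prop} :
    (∀ᵐ z ∂sigmaMeasure I μ, q z) ↔ ∀ i, ∀ᵐ x ∂μ, q ⟨i, x⟩ := by
  constructor
  · intro h i
    exact ae_of_ae_map (measurable_copyMk i).aemeasurable (ae_mono (map_copyMk_le i) h)
  · intro h
    let N : Set (Σ _ : I, X) := {z | z.2 ∈ toMeasurable μ {x | ¬ q ⟨z.1, x⟩}}
    have hN : MeasurableSet N :=
      measurableSet_sigma_iff.mpr fun i => measurableSet_toMeasurable μ {x | ¬ q ⟨i, x⟩}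
    have h0 : sigmaMeasure I μ N = 0 := by
      rw [sigmaMeasure, Measure.sum_apply _ hN, ENNReal.tsum_eq_zero]
      intro i
      rw [Measure.map_apply (measurable_copyMk i) hN]
      exact (measure_toMeasurable _).trans (h i)
    exact measure_mono_null (fun z hz => subset_toMeasurable μ {x | ¬ q ⟨z.1, x⟩} hz) h0

theorem lintegral_sigmaMeasure {f : (Σ _ : I, X) → ℝ≥0∞} (hf : Measurable f) :
    ∫⁻ z, f z ∂sigmaMeasure I μ = ∑' i, ∫⁻ x, f ⟨i, x⟩ ∂μ := by
  rw [sigmaMeasure, lintegral_sum_measure]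
  exact tsum_congr fun i => lintegral_map hf (measurable_copyMk i)

variable {p : ℝ≥0∞}

/-- Powers of norms are compared in `[0, ∞]`, where sums and integrals need no convergence
hypotheses. -/
theorem Lp.enorm_rpow_eq_lintegral {Y : Type w} [MeasurableSpace Y] {ν : Measure Y}
    (h0 : p ≠ 0) (hp : p ≠ ∞) (f : Lp ℂ p ν) :
    ‖f‖ₑ ^ p.toReal = ∫⁻ y, ‖f y‖ₑ ^ p.toReal ∂ν := by
  rw [Lp.enorm_def, eLpNorm_eq_lintegral_rpow_enorm_toReal h0 hp, ← ENNReal.rpow_mul,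
    one_div_mul_cancel (ENNReal.toReal_pos h0 hp).ne', ENNReal.rpow_one]

theorem lp.enorm_rpow_eq_tsum {E : Type w} [NormedAddCommGroup E] [Fact (1 ≤ p)] (h0 : 0 < p.toReal)
    (g : lp (fun _ : I => E) p) : ‖g‖ₑ ^ p.toReal = ∑' i, ‖g i‖ₑ ^ p.toReal := by
  have key : ∀ x : ℝ, 0 ≤ x → ENNReal.ofReal x ^ p.toReal = ENNReal.ofReal (x ^ p.toReal) :=
    fun x hx => ENNReal.ofReal_rpow_of_nonneg hx h0.le
  rw [← ofReal_norm, key _ (norm_nonneg _), lp.norm_rpow_eq_tsum h0,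
    ENNReal.ofReal_tsum_of_nonneg (fun i => by positivity) ((lp.memℓp g).summable h0)]
  exact tsum_congr fun i => by rw [← ofReal_norm, key _ (norm_nonneg _)]

/-- A family of functions, as a function on the disjoint union. -/
noncomputable def sigmaFun (g : I → Lp ℂ p μ) (z : Σ _ : I, X) : ℂ := g z.1 z.2

theorem measurable_sigmaFun (g : I → Lp ℂ p μ) : Measurable (sigmaFun g) :=
  measurable_sigma_iff.mpr fun i => (Lp.stronglyMeasurable (g i)).measurable

theorem lintegral_sigmaFun [Fact (1 ≤ p)] (hp : p ≠ ∞) (g : lp (fun _ : I => Lp ℂ p μ) p) :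
    ∫⁻ z, ‖sigmaFun g z‖ₑ ^ p.toReal ∂sigmaMeasure I μ = ‖g‖ₑ ^ p.toReal := by
  have h0 : p ≠ 0 := (zero_lt_one.trans_le Fact.out).ne'
  rw [lintegral_sigmaMeasure ((measurable_sigmaFun g).enorm.pow_const _),
    lp.enorm_rpow_eq_tsum (ENNReal.toReal_pos h0 hp)]
  exact tsum_congr fun i => (Lp.enorm_rpow_eq_lintegral h0 hp (g i)).symm

theorem eLpNorm_sigmaFun [Fact (1 ≤ p)] (hp : p ≠ ∞) (g : lp (fun _ : I => Lp ℂ p μ) p) :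
    eLpNorm (sigmaFun g) p (sigmaMeasure I μ) = ‖g‖ₑ := by
  have h0 : p ≠ 0 := (zero_lt_one.trans_le Fact.out).ne'
  rw [eLpNorm_eq_lintegral_rpow_enorm_toReal h0 hp, lintegral_sigmaFun hp, ← ENNReal.rpow_mul,
    mul_one_div_cancel (ENNReal.toReal_pos h0 hp).ne', ENNReal.rpow_one]

theorem memLp_sigmaFun [Fact (1 ≤ p)] (hp : p ≠ ∞) (g : lp (fun _ : I => Lp ℂ p μ) p) :
    MemLp (sigmaFun g) p (sigmaMeasure I μ) :=
  ⟨(measurable_sigmaFun g).aestronglyMeasurable, by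
    rw [eLpNorm_sigmaFun hp]; exact enorm_lt_top⟩

theorem memLp_comp_copyMk {f : (Σ _ : I, X) → ℂ} (hf : MemLp f p (sigmaMeasure I μ)) (i : I) :
    MemLp (fun x => f ⟨i, x⟩) p μ :=
  (hf.mono_measure (map_copyMk_le i)).comp_of_map (measurable_copyMk i).aemeasurable

/-- The `p`-th powers of the norms of the restrictions add up to the integral of `‖f‖ᵖ` over the
disjoint union, which is finite. -/
theorem memℓp_comp_copyMk [Fact (1 ≤ p)] (hp : p ≠ ∞) (f : Lp ℂ p (sigmaMeasure I μ)) :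
    Memℓp (fun i => (memLp_comp_copyMk (Lp.memLp f) i).toLp) p := by
  have h0 : p ≠ 0 := (zero_lt_one.trans_le Fact.out).ne'
  have hp0 : 0 < p.toReal := ENNReal.toReal_pos h0 hp
  refine memℓp_gen ?_
  have h1 : ∑' i, ‖(memLp_comp_copyMk (Lp.memLp f) i).toLp‖ₑ ^ p.toReal = ‖f‖ₑ ^ p.toReal := by
    rw [Lp.enorm_rpow_eq_lintegral h0 hp f,
      lintegral_sigmaMeasure ((Lp.stronglyMeasurable f).measurable.enorm.pow_const _)]
    refine tsum_congr fun i => ?_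
    rw [Lp.enorm_rpow_eq_lintegral h0 hp]
    exact lintegral_congr_ae ((MemLp.coeFn_toLp _).fun_comp (fun y => ‖y‖ₑ ^ p.toReal))
  have h2 : ∑' i, ‖(memLp_comp_copyMk (Lp.memLp f) i).toLp‖ₑ ^ p.toReal ≠ ∞ := by
    rw [h1]
    exact ENNReal.rpow_ne_top_of_nonneg hp0.le enorm_ne_top
  simpa [← ENNReal.toReal_rpow] using ENNReal.summable_toReal h2

/-- The `ℓᵖ`-direct sum of copies of `Lᵖ(μ)` is the `Lᵖ`-space of the disjoint union of copies
of `μ`. -/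
noncomputable def lpSigmaEquiv (I : Type u) (μ : Measure X) [Fact (1 ≤ p)] (hp : p ≠ ∞) :
    lp (fun _ : I => Lp ℂ p μ) p ≃ₗᵢ[ℂ] Lp ℂ p (sigmaMeasure I μ) :=
  LinearIsometryEquiv.ofSurjective
    { toFun := fun g => (memLp_sigmaFun hp g).toLp
      map_add' := fun g g' => by
        rw [← MemLp.toLp_add, MemLp.toLp_eq_toLp_iff]
        exact ae_sigmaMeasure_iff.mpr fun i => Lp.coeFn_add (g i) (g' i)
      map_smul' := fun c g => by
        rw [RingHom.id_apply, ← MemLp.toLp_const_smul, MemLp.toLp_eq_toLp_iff]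
        exact ae_sigmaMeasure_iff.mpr fun i => Lp.coeFn_smul c (g i)
      norm_map' := fun g => by
        change ‖(memLp_sigmaFun hp g).toLp‖ = ‖g‖
        rw [Lp.norm_toLp, eLpNorm_sigmaFun hp, toReal_enorm] } fun f => by
    -- The preimage of `f` is the family of its restrictions to the copies.
    refine ⟨⟨_, memℓp_comp_copyMk hp f⟩, ?_⟩
    change (memLp_sigmaFun hp _).toLp = f
    refine Lp.ext ((MemLp.coeFn_toLp _).trans ?_)
    exact ae_sigmaMeasure_iff.mpr fun i => (memLp_comp_copyMk (Lp.memLp f) i).coeFn_toLp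

end SigmaMeasure

namespace DirGraph

/-! ### Relative Cuntz–Krieger families and their dilations -/

/-- A family of operators for a graph `H` which is supported on a set `F` of edges and satisfies
the Cuntz–Krieger relation at those vertices which are the range of some edge in `F`. -/
structure IsRelativeCKFamily (H : DirGraph.{u}) (F : Set H.E) {A : Type v} [NormedRing A]
    [NormedAlgebra ℂ A] (S T : H.E → A) (P : H.V → A) : Prop where
  s_eq_zero : ∀ a ∉ F, S a = 0
  t_eq_zero : ∀ a ∉ F, T a = 0
  e_hermitian : ∀ x, IsHermitianIdem (P x)
  e_orthogonal : ∀ x y, x ≠ y → P x * P y = 0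
  norm_s_le : ∀ a, ‖S a‖ ≤ 1
  norm_t_le : ∀ a, ‖T a‖ ≤ 1
  st_hermitian : ∀ a, IsHermitianIdem (S a * T a)
  e_mul_s : ∀ a, P (H.r a) * S a = S a
  s_mul_e : ∀ a, S a * P (H.s a) = S a
  t_mul_e : ∀ a, T a * P (H.r a) = T a
  e_mul_t : ∀ a, P (H.s a) * T a = T a
  t_mul_s_self : ∀ a ∈ F, T a * S a = P (H.s a)
  t_mul_s : ∀ a b, a ≠ b → T a * S b = 0
  ck2 : ∀ (x : H.V) (h : {a | H.r a = x}.Finite), (∃ a ∈ F, H.r a = x) →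
    P x = ∑ a ∈ h.toFinset, S a * T a

/-! ### Backward paths and the matrix entries of the dilation -/

section Nodes

variable {H : DirGraph.{u}}

open Classical in
/-- A chosen edge with range `x`, if there is one. -/
noncomputable def nextEdge (x : H.V) : Option H.E :=
  if h : ∃ a, H.r a = x then some h.choose else none

theorem r_of_nextEdge {x : H.V} {a : H.E} (h : nextEdge x = some a) : H.r a = x := by
  unfold nextEdge at h
  split_ifs at h with h'
  obtain rfl := Option.some.inj h
  exact h'.choose_spec

theorem exists_nextEdge {x : H.V} (h : ∃ a, H.r a = x) : ∃ a, nextEdge x = some a := by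
  unfold nextEdge
  rw [dif_pos h]
  exact ⟨_, rfl⟩

variable (F : Set H.E)

open Classical in
/-- The edges of a chosen backward path from a vertex `x` that receives no edge of `F`. -/
noncomputable def descEdge (x : H.V) : ℕ → Option H.E
  | 0 => if ∃ a ∈ F, H.r a = x then none else nextEdge x
  | n + 1 => (descEdge x n).bind fun a => nextEdge (H.s a)

variable {F}

theorem r_of_descEdge_zero {x : H.V} {a : H.E} (h : descEdge F x 0 = some a) : H.r a = x := by
  unfold descEdge at h
  split_ifs at h
  exact r_of_nextEdge h

/-- This separates the two sources of the summation relation at the base: it is inherited when an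
edge of `F` ends at `x`, and supplied by a descending path otherwise, never both. -/
theorem notMem_of_descEdge_zero {x : H.V} {a b : H.E} (h : descEdge F x 0 = some a)
    (hb : b ∈ F) : H.r b ≠ x := by
  unfold descEdge at h
  split_ifs at h with h'
  exact fun hr => h' ⟨b, hb, hr⟩

theorem exists_descEdge_zero {x : H.V} (h : ¬ ∃ a ∈ F, H.r a = x) (h' : ∃ a, H.r a = x) :
    ∃ a, descEdge F x 0 = some a := by
  unfold descEdge
  rw [if_neg h]
  exact exists_nextEdge h'

theorem exists_of_descEdge_succ {x : H.V} {n : ℕ} {a : H.E} (h : descEdge F x (n + 1) = some a) :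
    ∃ b, descEdge F x n = some b ∧ H.s b = H.r a := by
  rw [descEdge, Option.bind_eq_some_iff] at h
  obtain ⟨b, hb, hb'⟩ := h
  exact ⟨b, hb, (r_of_nextEdge hb').symm⟩

theorem exists_descEdge_succ {x : H.V} {n : ℕ} {a : H.E} (h : descEdge F x n = some a)
    (h' : ∃ b, H.r b = H.s a) : ∃ b, descEdge F x (n + 1) = some b := by
  obtain ⟨b, hb⟩ := exists_nextEdge h'
  exact ⟨b, by rw [descEdge, h]; exact hb⟩

variable (H) in
/-- The summands of the dilation: the given space, and its formal translates. -/
inductive Node : Type u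
  | base : Node
  | down (x : H.V) (n : ℕ) : Node
  | up (a : H.E) (y : Node) : Node

namespace Node

variable (F) in
/-- The edge `a` does not translate the summand `y` freely, but into an existing one. -/
def Absorbs (a : H.E) : Node H → Prop
  | base => a ∈ F
  | down x n => descEdge F x n = some a
  | up _ _ => False

@[simp] theorem absorbs_base {a : H.E} : Absorbs F a base ↔ a ∈ F := Iff.rfl
@[simp] theorem absorbs_down {a : H.E} {x : H.V} {n : ℕ} :
    Absorbs F a (down x n) ↔ descEdge F x n = some a := Iff.rfl
@[simp] theorem absorbs_up {a b : H.E} {y : Node H} : Absorbs F a (up b y) ↔ False := Iff.rfl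

/-- The neighbour of a summand in the direction of its base. -/
def prev : Node H → Node H
  | base => base
  | down _ 0 => base
  | down x (n + 1) => down x n
  | up _ y => y

variable {A : Type v} [Ring A] (S T : H.E → A) (P : H.V → A)

open Classical in
variable (F) in
/-- The diagonal entries of the vertex projections of the dilation. -/
noncomputable def proj : H.V → Node H → A
  | v, base => P v
  | v, down x n => if (descEdge F x n).map H.s = some v then P x else 0
  | v, up a y => if H.r a = v ∧ ¬ Absorbs F a y then proj (H.s a) y else 0

open Classical in
variable (F) in
/-- The entries of the operators `S_a` of the dilation. -/
noncomputable def sWeight (a : H.E) : Node H → A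
  | base => if a ∈ F then S a else if descEdge F (H.r a) 0 = some a then P (H.r a) else 0
  | down x n => if descEdge F x (n + 1) = some a then P x else 0
  | up b y => if b = a ∧ ¬ Absorbs F a y then proj F P (H.s a) y else 0

open Classical in
variable (F) in
/-- The positions of the entries of the operators `S_a` of the dilation. -/
noncomputable def sIndex (a : H.E) : Node H → Node H
  | base => if a ∈ F then base else down (H.r a) 0
  | down x n => down x (n + 1)
  | up _ y => y

open Classical in
variable (F) in
/-- The entries of the operators `T_a` of the dilation. -/
noncomputable def tWeight (a : H.E) : Node H → A
  | base => if a ∈ F then T a else P (H.s a)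
  | down x n => if descEdge F x n = some a then P x else proj F P (H.s a) (down x n)
  | up b y => proj F P (H.s a) (up b y)

open Classical in
variable (F) in
/-- The positions of the entries of the operators `T_a` of the dilation. -/
noncomputable def tIndex (a : H.E) (y : Node H) : Node H := if Absorbs F a y then prev y else up a y

/-- This composition is the identity at every summand. The opposite one is the identity only where
the weight of `S_a` is nonzero (`tIndex_sIndex`), because elsewhere `sIndex` takes default values.
-/
theorem sIndex_tIndex (a : H.E) (y : Node H) : sIndex F a (tIndex F a y) = y := by
  unfold tIndex
  split_ifs with h
  · match y, h with
    | base, h => exact if_pos h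
    | down x 0, h =>
      have hr := r_of_descEdge_zero h
      -- This selects the branch of `sIndex` at the base that leads back to `down (H.r a) 0`.
      have ha : a ∉ F := fun ha => notMem_of_descEdge_zero h ha hr
      simp [prev, sIndex, ha, hr]
    | down x (n + 1), h => rfl
  · rfl

theorem tIndex_injective (a : H.E) : Function.Injective (tIndex F a) :=
  Function.LeftInverse.injective (sIndex_tIndex a)

variable {S P} in
theorem tIndex_sIndex {a : H.E} {y : Node H} (h : sWeight F S P a y ≠ 0) :
    tIndex F a (sIndex F a y) = y := by
  cases y with
  | base =>
    by_cases ha : a ∈ F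
    · simp [sIndex, tIndex, ha, prev]
    · by_cases hd : descEdge F (H.r a) 0 = some a
      · simp [sIndex, tIndex, ha, hd, prev]
      · simp [sWeight, ha, hd] at h
  | down x n =>
    by_cases hd : descEdge F x (n + 1) = some a
    · simp [sIndex, tIndex, hd, prev]
    · simp [sWeight, hd] at h
  | up b y =>
    by_cases hd : b = a ∧ ¬ Absorbs F a y
    · obtain ⟨rfl, hd⟩ := hd
      simp [sIndex, tIndex, hd]
    · simp [sWeight, hd] at h

variable {S P} in
theorem sIndex_injOn (a : H.E) : Set.InjOn (sIndex F a) {y | sWeight F S P a y ≠ 0} :=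
  fun x hx y hy h => by rw [← tIndex_sIndex hx, h, tIndex_sIndex hy]

/-- The recursion through `up` only copies an entry further down. Idempotence, hermiticity and the
norm bound for all entries thus come from the original projections. -/
theorem proj_eq_zero_or (v : H.V) (y : Node H) :
    proj F P v y = 0 ∨ ∃ x, proj F P v y = P x := by
  induction y generalizing v with
  | base => exact .inr ⟨v, rfl⟩
  | down x n =>
    unfold proj
    split_ifs
    · exact .inr ⟨x, rfl⟩
    · exact .inl rfl
  | up a y ih =>
    unfold proj
    split_ifs
    · exact ih _
    · exact .inl rfl

/-- A summand other than the base lies over at most one vertex, so the hypothesis is used only at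
the base. -/
theorem proj_orthogonal (hP : ∀ x y, x ≠ y → P x * P y = 0) {v w : H.V} (h : v ≠ w)
    (y : Node H) : proj F P v y * proj F P w y = 0 := by
  cases y with
  | base => exact hP v w h
  | down x n =>
    unfold proj
    split_ifs with h1 h2
    · exact absurd (Option.some.inj (h1.symm.trans h2)) h
    all_goals simp
  | up a y =>
    unfold proj
    split_ifs with h1 h2
    · exact absurd (h1.1.symm.trans h2.1) h
    all_goals simp

theorem proj_down_of_eq {x : H.V} {n : ℕ} {a : H.E} (h : descEdge F x n = some a) :
    proj F P (H.s a) (down x n) = P x := by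
  simp [proj, h]

theorem tWeight_of_not_absorbs {a : H.E} {y : Node H} (h : ¬ Absorbs F a y) :
    tWeight F T P a y = proj F P (H.s a) y := by
  cases y with
  | base => exact if_neg h
  | down x n => exact if_neg h
  | up b y => rfl

theorem sWeight_up_of_not_absorbs {a : H.E} {y : Node H} (h : ¬ Absorbs F a y) :
    sWeight F S P a (up a y) = proj F P (H.s a) y := by
  simp [sWeight, h]

theorem proj_up_of_not_absorbs {a : H.E} {y : Node H} (h : ¬ Absorbs F a y) :
    proj F P (H.r a) (up a y) = proj F P (H.s a) y := by
  simp [proj, h]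

end Node
end Nodes

/-! ### The Cuntz–Krieger relations for the matrix entries -/

namespace IsRelativeCKFamily

open Node

variable {H : DirGraph.{u}} {F : Set H.E} {A : Type v} [NormedRing A] [NormedAlgebra ℂ A]
  {S T : H.E → A} {P : H.V → A} (h : H.IsRelativeCKFamily F S T P)
include h

theorem proj_mul_self (v : H.V) (y : Node H) : proj F P v y * proj F P v y = proj F P v y := by
  rcases proj_eq_zero_or (F := F) P v y with h0 | ⟨x, h0⟩
  · simp [h0]
  · rw [h0]; exact (h.e_hermitian x).1

theorem isHermitianIdem_proj (h1 : ‖(1 : A)‖ ≤ 1) (v : H.V) (y : Node H) :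
    IsHermitianIdem (proj F P v y) := by
  rcases proj_eq_zero_or (F := F) P v y with h0 | ⟨x, h0⟩
  · rw [h0]; exact isHermitianIdem_zero h1
  · rw [h0]; exact h.e_hermitian x

/-- Replacing `S a` by `S a * T a` in `sWeight` gives the diagonal entries of `S_a T_a` in the
dilation, by `sWeight_mul_tWeight`. -/
theorem isHermitianIdem_stWeight (h1 : ‖(1 : A)‖ ≤ 1) (a : H.E) (y : Node H) :
    IsHermitianIdem (sWeight F (fun a => S a * T a) P a y) := by
  cases y <;> simp only [sWeight] <;> (try split_ifs) <;>
    first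
    | exact h.st_hermitian _
    | exact h.e_hermitian _
    | exact isHermitianIdem_zero h1
    | exact h.isHermitianIdem_proj h1 _ _

theorem proj_mul_sWeight (a : H.E) (y : Node H) :
    proj F P (H.r a) y * sWeight F S P a y = sWeight F S P a y := by
  cases y with
  | base =>
    simp only [sWeight]
    split_ifs
    · exact h.e_mul_s a
    · exact (h.e_hermitian _).1
    · exact mul_zero _
  | down x n =>
    simp only [sWeight]
    split_ifs with hd
    -- The summand `down x n` lies over the source of the `n`-th edge of the path, which is the
    -- range of the following edge `a`.
    · obtain ⟨b, hb, hb'⟩ := exists_of_descEdge_succ hd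
      rw [← hb', proj_down_of_eq P hb]
      exact (h.e_hermitian _).1
    · exact mul_zero _
  | up b y =>
    simp only [sWeight]
    split_ifs with hd
    · obtain ⟨rfl, hd⟩ := hd
      rw [proj_up_of_not_absorbs P hd, h.proj_mul_self]
    · exact mul_zero _

theorem sWeight_mul_proj (a : H.E) (y : Node H) :
    sWeight F S P a y * proj F P (H.s a) (sIndex F a y) = sWeight F S P a y := by
  cases y with
  | base =>
    simp only [sWeight, sIndex]
    split_ifs with h1 hd
    · exact h.s_mul_e a
    · rw [proj_down_of_eq P hd]
      exact (h.e_hermitian _).1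
    · exact zero_mul _
  | down x n =>
    simp only [sWeight, sIndex]
    split_ifs with hd
    · rw [proj_down_of_eq P hd]
      exact (h.e_hermitian _).1
    · exact zero_mul _
  | up b y =>
    simp only [sWeight, sIndex]
    split_ifs with hd
    · exact h.proj_mul_self _ _
    · exact zero_mul _

theorem tWeight_mul_proj (a : H.E) (y : Node H) :
    tWeight F T P a y * proj F P (H.r a) (tIndex F a y) = tWeight F T P a y := by
  by_cases ha : Absorbs F a y
  -- The start `down x 0` of a path is treated apart, because its predecessor is the base.
  · match y, ha with
    | base, ha =>
      rw [absorbs_base] at ha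
      simp only [tWeight, tIndex, absorbs_base, ha, if_true, prev, proj]
      exact h.t_mul_e a
    | down x 0, ha =>
      rw [absorbs_down] at ha
      simp only [tWeight, tIndex, absorbs_down, ha, if_true, prev, proj, r_of_descEdge_zero ha]
      exact (h.e_hermitian _).1
    | down x (n + 1), ha =>
      rw [absorbs_down] at ha
      obtain ⟨b, hb, hb'⟩ := exists_of_descEdge_succ ha
      simp only [tWeight, tIndex, absorbs_down, ha, if_true, prev]
      rw [← hb', proj_down_of_eq P hb]
      exact (h.e_hermitian _).1
  · rw [tWeight_of_not_absorbs T P ha, tIndex, if_neg ha, proj_up_of_not_absorbs P ha,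
      h.proj_mul_self]

theorem proj_mul_tWeight (a : H.E) (y : Node H) :
    proj F P (H.s a) y * tWeight F T P a y = tWeight F T P a y := by
  by_cases ha : Absorbs F a y
  · match y, ha with
    | base, ha =>
      rw [absorbs_base] at ha
      simp only [tWeight, ha, if_true]
      exact h.e_mul_t a
    | down x n, ha =>
      rw [absorbs_down] at ha
      simp only [tWeight, ha, if_true, proj_down_of_eq P ha]
      exact (h.e_hermitian _).1
  · rw [tWeight_of_not_absorbs T P ha, h.proj_mul_self]

/-- At the base with `a ∈ F` this is the original relation. Along a descending path both weights are
the same idempotent `P x`. In the remaining case `S_a` moves `y` to its free copy and `T_a` moves it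
back. -/
theorem tWeight_mul_sWeight_self (a : H.E) (y : Node H) :
    tWeight F T P a y * sWeight F S P a (tIndex F a y) = proj F P (H.s a) y := by
  by_cases ha : Absorbs F a y
  · match y, ha with
    | base, ha =>
      rw [absorbs_base] at ha
      simp only [tWeight, tIndex, absorbs_base, ha, if_true, prev, sWeight]
      exact h.t_mul_s_self a ha
    | down x 0, ha =>
      rw [absorbs_down] at ha
      have hr := r_of_descEdge_zero ha
      have haF : a ∉ F := fun haF => notMem_of_descEdge_zero ha haF hr
      simp only [tWeight, tIndex, absorbs_down, ha, if_true, prev, sWeight, haF, if_false, hr,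
        proj_down_of_eq P ha]
      exact (h.e_hermitian _).1
    | down x (n + 1), ha =>
      rw [absorbs_down] at ha
      simp only [tWeight, tIndex, absorbs_down, ha, if_true, prev, sWeight, proj_down_of_eq P ha]
      exact (h.e_hermitian _).1
  · rw [tWeight_of_not_absorbs T P ha, tIndex, if_neg ha, sWeight_up_of_not_absorbs S P ha,
      h.proj_mul_self]

/-- A free copy `up a y` is reached only by `S_a`, and `down x n` only by the next edge of its path.
The base is the one summand that several edges can enter. -/
theorem tWeight_mul_sWeight {a b : H.E} (hab : a ≠ b) (y : Node H) :
    tWeight F T P a y * sWeight F S P b (tIndex F a y) = 0 := by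
  by_cases ha : Absorbs F a y
  · match y, ha with
    | base, ha =>
      rw [absorbs_base] at ha
      simp only [tWeight, tIndex, absorbs_base, ha, if_true, prev, sWeight]
      split_ifs with hb hd
      · exact h.t_mul_s a b hab
      -- No edge of `F` ends where the path of `b` starts, so `a` and `b` have different ranges.
      · rw [← h.t_mul_e, mul_assoc, h.e_orthogonal _ _ (notMem_of_descEdge_zero hd ha), mul_zero]
      · exact mul_zero _
    | down x 0, ha =>
      rw [absorbs_down] at ha
      simp only [tWeight, tIndex, absorbs_down, ha, if_true, prev, sWeight]
      split_ifs with hb hd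
      · rw [← h.e_mul_s, ← mul_assoc, h.e_orthogonal _ _ (notMem_of_descEdge_zero ha hb).symm,
          zero_mul]
      -- Both edges start descending paths; if these started at the same vertex, the edges would
      -- coincide.
      · refine h.e_orthogonal _ _ fun hx => hab ?_
        rw [← hx] at hd
        exact Option.some.inj (ha.symm.trans hd)
      · exact mul_zero _
    | down x (n + 1), ha =>
      rw [absorbs_down] at ha
      have hb : descEdge F x (n + 1) ≠ some b := fun hb => hab (Option.some.inj (ha.symm.trans hb))
      simp only [tIndex, absorbs_down, ha, if_true, prev, sWeight]
      rw [if_neg hb, mul_zero]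
  · rw [tIndex, if_neg ha]
    simp [sWeight, hab]

theorem sWeight_mul_tWeight (a : H.E) (y : Node H) :
    sWeight F S P a y * tWeight F T P a (sIndex F a y) =
      sWeight F (fun a => S a * T a) P a y := by
  cases y with
  | base =>
    simp only [sWeight, sIndex]
    split_ifs with h1 hd
    · simp [tWeight, h1]
    · simp only [tWeight, hd, if_true]
      exact (h.e_hermitian _).1
    · exact zero_mul _
  | down x n =>
    simp only [sWeight, sIndex]
    split_ifs with hd
    · simp only [tWeight, hd, if_true]
      exact (h.e_hermitian _).1
    · exact zero_mul _
  | up b y =>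
    simp only [sWeight, sIndex]
    split_ifs with hd
    · rw [tWeight_of_not_absorbs T P hd.2, h.proj_mul_self]
    · exact zero_mul _

/-- The given relation is used only at the base, when an edge of `F` ends at `x`. Everywhere else at
most one edge contributes: the next edge of the path at `base` or `down`, and the attached edge `b`
at `up b y`. -/
theorem proj_eq_sum (x : H.V) (hx : {a | H.r a = x}.Finite) (hne : {a | H.r a = x}.Nonempty)
    (y : Node H) :
    proj F P x y = ∑ a ∈ hx.toFinset, sWeight F (fun a => S a * T a) P a y := by
  have mem : ∀ {a}, a ∈ hx.toFinset ↔ H.r a = x := by simp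
  cases y with
  | base =>
    by_cases hF : ∃ a ∈ F, H.r a = x
    · refine (h.ck2 x hx hF).trans (Finset.sum_congr rfl fun a ha => ?_)
      simp only [sWeight]
      split_ifs with haF hd
      · rfl
      -- An edge outside `F` could enter the base only by starting a path at `x`, and none starts
      -- there.
      · rw [mem.mp ha] at hd
        obtain ⟨b, hb, hb'⟩ := hF
        exact absurd hb' (notMem_of_descEdge_zero hd hb)
      · rw [h.s_eq_zero a haF, zero_mul]
    · obtain ⟨a, ha⟩ := exists_descEdge_zero hF hne
      have hr := r_of_descEdge_zero ha
      rw [Finset.sum_eq_single_of_mem a (mem.mpr hr)]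
      · have haF : a ∉ F := fun haF => hF ⟨a, haF, hr⟩
        simp only [sWeight, haF, if_false, hr, ha, if_true, proj]
      · intro b hb hba
        have hb := mem.mp hb
        have hbF : b ∉ F := fun hbF => hF ⟨b, hbF, hb⟩
        have hd : descEdge F (H.r b) 0 ≠ some b := by
          rw [hb, ha]
          exact fun e => hba (Option.some.inj e).symm
        simp only [sWeight, hbF, hd, if_false]
  | down z n =>
    by_cases hd : (descEdge F z n).map H.s = some x
    · obtain ⟨b, hb, rfl⟩ := Option.map_eq_some_iff.mp hd
      -- Since `x` receives an edge, the path does not stop here.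
      obtain ⟨a, ha⟩ := exists_descEdge_succ hb hne
      obtain ⟨b', hb', hr⟩ := exists_of_descEdge_succ ha
      obtain rfl := Option.some.inj (hb.symm.trans hb')
      rw [proj_down_of_eq P hb, Finset.sum_eq_single_of_mem a (mem.mpr hr.symm)]
      · simp only [sWeight, ha, if_true]
      · intro c _ hca
        have hc : descEdge F z (n + 1) ≠ some c := by
          rw [ha]
          exact fun e => hca (Option.some.inj e).symm
        simp only [sWeight, hc, if_false]
    · rw [Finset.sum_eq_zero]
      · simp only [proj, hd, if_false]
      · intro a ha
        simp only [sWeight]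
        rw [if_neg]
        intro ha'
        obtain ⟨b, hb, hr⟩ := exists_of_descEdge_succ ha'
        exact hd (by rw [hb, Option.map_some, hr, mem.mp ha])
  | up b y =>
    by_cases hb : H.r b = x
    · rw [Finset.sum_eq_single_of_mem b (mem.mpr hb)]
      · simp only [proj, sWeight]
        by_cases hy : Absorbs F b y
        -- If `b` absorbs `y`, then `up b y` is an idle summand on which all these entries vanish.
        · rw [if_neg fun e => e.2 hy, if_neg fun e => e.2 hy]
        · rw [if_pos ⟨hb, hy⟩, if_pos ⟨rfl, hy⟩]
      · intro c _ hcb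
        simp [sWeight, hcb.symm]
    · rw [Finset.sum_eq_zero]
      · simp [proj, hb]
      · intro a ha
        simp only [sWeight]
        rw [if_neg]
        rintro ⟨rfl, -⟩
        exact hb (mem.mp ha)

theorem norm_sWeight_le [CompleteSpace A] (a : H.E) (y : Node H) : ‖sWeight F S P a y‖ ≤ 1 := by
  cases y <;> simp only [sWeight] <;> (try split_ifs) <;>
    first
    | exact h.norm_s_le _
    | exact (h.e_hermitian _).norm_le
    | simp
    | (rcases proj_eq_zero_or (F := F) P _ _ with h0 | ⟨x, h0⟩ <;> rw [h0])
  · simp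
  · exact (h.e_hermitian _).norm_le

theorem norm_proj_le [CompleteSpace A] (v : H.V) (y : Node H) : ‖proj F P v y‖ ≤ 1 := by
  rcases proj_eq_zero_or (F := F) P v y with h0 | ⟨x, h0⟩ <;> rw [h0]
  · simp
  · exact (h.e_hermitian _).norm_le

theorem norm_tWeight_le [CompleteSpace A] (a : H.E) (y : Node H) : ‖tWeight F T P a y‖ ≤ 1 := by
  cases y <;> simp only [tWeight] <;> try split_ifs
  all_goals
    first
    | exact h.norm_t_le _
    | exact (h.e_hermitian _).norm_le
    | exact h.norm_proj_le _ _

end IsRelativeCKFamily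
end DirGraph

/-! ### The dilation as operators on an `ℓᵖ`-direct sum -/

namespace DirGraph

namespace IsRelativeCKFamily

open Node

section BaseIncl

variable (H : DirGraph.{u}) (E : Type v) [NormedAddCommGroup E] [NormedSpace ℂ E] (p : ℝ≥0∞)
  [Fact (1 ≤ p)]

open Classical in
/-- The inclusion of the given space as the base summand of the dilation. -/
noncomputable def baseIncl : E →L[ℂ] lp (fun _ : Node H => E) p :=
  lp.singleContinuousLinearMap ℂ (fun _ : Node H => E) p base

variable {H E p}

theorem baseIncl_base (ξ : E) : baseIncl H E p ξ base = ξ := by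
  classical exact lp.single_apply_self (E := fun _ : Node H => E) p base ξ

theorem baseIncl_of_ne {y : Node H} (hy : y ≠ base) (ξ : E) : baseIncl H E p ξ y = 0 := by
  classical exact lp.single_apply_ne (E := fun _ : Node H => E) p base ξ hy

theorem norm_baseIncl (ξ : E) : ‖baseIncl H E p ξ‖ = ‖ξ‖ := by
  classical exact lp.norm_single (E := fun _ : Node H => E) (zero_lt_one.trans_le Fact.out) base ξ

end BaseIncl

variable {H : DirGraph.{u}} {F : Set H.E} {E : Type v} [NormedAddCommGroup E] [NormedSpace ℂ E]
  [CompleteSpace E] {S T : H.E → E →L[ℂ] E} {P : H.V → E →L[ℂ] E}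
  (h : H.IsRelativeCKFamily F S T P) {p : ℝ≥0∞} [Fact (1 ≤ p)] (hp : p ≠ ∞)

/-- The operators `S_a` of the dilation. -/
noncomputable def dilationS (a : H.E) :
    lp (fun _ : Node H => E) p →L[ℂ] lp (fun _ : Node H => E) p :=
  lpMonomial hp (sIndex F a) (sWeight F S P a) (h.norm_sWeight_le a) (sIndex_injOn a)

/-- The operators `T_a` of the dilation. -/
noncomputable def dilationT (a : H.E) :
    lp (fun _ : Node H => E) p →L[ℂ] lp (fun _ : Node H => E) p :=
  lpMonomial hp (tIndex F a) (tWeight F T P a) (h.norm_tWeight_le a) (tIndex_injective a).injOn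

/-- The vertex projections of the dilation. -/
noncomputable def dilationP (x : H.V) :
    lp (fun _ : Node H => E) p →L[ℂ] lp (fun _ : Node H => E) p :=
  lpMonomial hp id (proj F P x) (h.norm_proj_le x) (Set.injOn_id _)

theorem dilationS_apply (a : H.E) (f : lp (fun _ : Node H => E) p) (y : Node H) :
    h.dilationS hp a f y = sWeight F S P a y (f (sIndex F a y)) := rfl

theorem dilationT_apply (a : H.E) (f : lp (fun _ : Node H => E) p) (y : Node H) :
    h.dilationT hp a f y = tWeight F T P a y (f (tIndex F a y)) := rfl

theorem dilationP_apply (x : H.V) (f : lp (fun _ : Node H => E) p) (y : Node H) :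
    h.dilationP hp x f y = proj F P x y (f y) := rfl

/-- The product is diagonal: wherever its entry is nonzero, the two index maps cancel by
`tIndex_sIndex`. -/
theorem dilationS_mul_dilationT_apply (a : H.E) (f : lp (fun _ : Node H => E) p) (y : Node H) :
    (h.dilationS hp a * h.dilationT hp a) f y = sWeight F (fun a => S a * T a) P a y (f y) := by
  rw [mul_apply_eq_comp, dilationS_apply, dilationT_apply, ← mul_apply_eq_comp,
    h.sWeight_mul_tWeight]
  by_cases h0 : sWeight F (fun a => S a * T a) P a y = 0
  · rw [h0]; rfl
  · rw [tIndex_sIndex h0]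

theorem dilationT_mul_dilationS_self (a : H.E) :
    h.dilationT hp a * h.dilationS hp a = h.dilationP hp (H.s a) := by
  refine ContinuousLinearMap.ext fun f => lp.ext (funext fun y => ?_)
  rw [mul_apply_eq_comp, dilationT_apply, dilationS_apply, ← mul_apply_eq_comp,
    h.tWeight_mul_sWeight_self, sIndex_tIndex, dilationP_apply]

theorem dilationP_mul_dilationS (a : H.E) :
    h.dilationP hp (H.r a) * h.dilationS hp a = h.dilationS hp a := by
  refine ContinuousLinearMap.ext fun f => lp.ext (funext fun y => ?_)
  rw [mul_apply_eq_comp, dilationP_apply, dilationS_apply, ← mul_apply_eq_comp,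
    h.proj_mul_sWeight]

theorem dilationS_mul_dilationP (a : H.E) :
    h.dilationS hp a * h.dilationP hp (H.s a) = h.dilationS hp a := by
  refine ContinuousLinearMap.ext fun f => lp.ext (funext fun y => ?_)
  rw [mul_apply_eq_comp, dilationS_apply, dilationP_apply, ← mul_apply_eq_comp,
    h.sWeight_mul_proj, dilationS_apply]

theorem dilationT_mul_dilationP (a : H.E) :
    h.dilationT hp a * h.dilationP hp (H.r a) = h.dilationT hp a := by
  refine ContinuousLinearMap.ext fun f => lp.ext (funext fun y => ?_)
  rw [mul_apply_eq_comp, dilationT_apply, dilationP_apply, ← mul_apply_eq_comp,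
    h.tWeight_mul_proj, dilationT_apply]

theorem dilationP_mul_dilationT (a : H.E) :
    h.dilationP hp (H.s a) * h.dilationT hp a = h.dilationT hp a := by
  refine ContinuousLinearMap.ext fun f => lp.ext (funext fun y => ?_)
  rw [mul_apply_eq_comp, dilationP_apply, dilationT_apply, ← mul_apply_eq_comp,
    h.proj_mul_tWeight]

theorem isHermitianIdem_dilationP (x : H.V) : IsHermitianIdem (h.dilationP hp x) :=
  isHermitianIdem_of_apply hp (proj F P x)
    (h.isHermitianIdem_proj ContinuousLinearMap.norm_id_le x) _ (h.dilationP_apply hp x)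

/-- The dilation of a relative Cuntz–Krieger family is a Cuntz–Krieger family. -/
theorem isCKFamily_dilation :
    H.IsCKFamily (h.dilationS hp) (h.dilationT hp) (h.dilationP hp) where
  e_hermitian := h.isHermitianIdem_dilationP hp
  e_orthogonal x x' hne := by
    refine ContinuousLinearMap.ext fun f => lp.ext (funext fun y => ?_)
    rw [mul_apply_eq_comp, dilationP_apply, dilationP_apply, ← mul_apply_eq_comp,
      proj_orthogonal P h.e_orthogonal hne]
    rfl
  norm_s_le a := norm_lpMonomial_le _ _ _ _ _
  norm_t_le a := norm_lpMonomial_le _ _ _ _ _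
  sts a := by rw [mul_assoc, dilationT_mul_dilationS_self, dilationS_mul_dilationP]
  tst a := by rw [dilationT_mul_dilationS_self, dilationP_mul_dilationT]
  st_hermitian a := isHermitianIdem_of_apply hp _
    (h.isHermitianIdem_stWeight ContinuousLinearMap.norm_id_le a) _
    (h.dilationS_mul_dilationT_apply hp a)
  ts_hermitian a := by
    rw [dilationT_mul_dilationS_self]
    exact h.isHermitianIdem_dilationP hp _
  e_mul_s := h.dilationP_mul_dilationS hp
  s_mul_e := h.dilationS_mul_dilationP hp
  t_mul_e := h.dilationT_mul_dilationP hp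
  e_mul_t := h.dilationP_mul_dilationT hp
  t_mul_s_self := h.dilationT_mul_dilationS_self hp
  t_mul_s a b hne := by
    refine ContinuousLinearMap.ext fun f => lp.ext (funext fun y => ?_)
    rw [mul_apply_eq_comp, dilationT_apply, dilationS_apply, ← mul_apply_eq_comp,
      h.tWeight_mul_sWeight hne]
    rfl
  ck2 x hx hne := by
    refine ContinuousLinearMap.ext fun f => lp.ext (funext fun y => ?_)
    rw [dilationP_apply, h.proj_eq_sum x hx hne, sum_apply,
      sum_apply, lp.coeFn_sum, Finset.sum_apply]
    exact Finset.sum_congr rfl fun a _ => (h.dilationS_mul_dilationT_apply hp a f y).symm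

theorem dilationP_baseIncl (x : H.V) (ξ : E) :
    h.dilationP hp x (baseIncl H E p ξ) = baseIncl H E p (P x ξ) := by
  refine lp.ext (funext fun y => ?_)
  rw [dilationP_apply]
  by_cases hy : y = base
  · subst hy
    rw [baseIncl_base, baseIncl_base]
    rfl
  · rw [baseIncl_of_ne hy, baseIncl_of_ne hy, map_zero]

/-- Only `base` and the summands `up b base` can read the base component. For `a ∈ F` the latter
have weight zero in `S_a`, because `a` absorbs the base. -/
theorem dilationS_baseIncl {a : H.E} (ha : a ∈ F) (ξ : E) :
    h.dilationS hp a (baseIncl H E p ξ) = baseIncl H E p (S a ξ) := by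
  refine lp.ext (funext fun y => ?_)
  rw [dilationS_apply]
  match y with
  | base => simp only [sIndex, ha, if_true, baseIncl_base, sWeight]
  | down x n =>
    simp only [sIndex]
    rw [baseIncl_of_ne (by simp), baseIncl_of_ne (by simp), map_zero]
  | up b base =>
    rw [baseIncl_of_ne (y := up b base) (by simp)]
    simp only [sWeight]
    rw [if_neg]
    · rfl
    · simp [ha]
  | up b (down x n) =>
    simp only [sIndex]
    rw [baseIncl_of_ne (by simp), baseIncl_of_ne (by simp), map_zero]
  | up b (up c y) =>
    simp only [sIndex]
    rw [baseIncl_of_ne (by simp), baseIncl_of_ne (by simp), map_zero]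

theorem dilationT_baseIncl {a : H.E} (ha : a ∈ F) (ξ : E) :
    h.dilationT hp a (baseIncl H E p ξ) = baseIncl H E p (T a ξ) := by
  refine lp.ext (funext fun y => ?_)
  rw [dilationT_apply]
  by_cases hy : y = base
  · subst hy
    simp only [tIndex, absorbs_base, ha, if_true, prev, baseIncl_base, tWeight]
  · have hb : tIndex F a base = base := by simp [tIndex, ha, prev]
    -- As `base` is sent to itself and `tIndex` is injective, no other summand reads the base
    -- component.
    have hy' : tIndex F a y ≠ base := fun e => hy (tIndex_injective a (e.trans hb.symm))
    rw [baseIncl_of_ne hy, baseIncl_of_ne hy', map_zero]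

end IsRelativeCKFamily

/-- A representation of `L_G` extends by zero to a relative family for any graph `H` in which `G`
is a Cuntz–Krieger subgraph. -/
theorem IsCKFamily.extend {G H : DirGraph.{u}} (i : CKEmbedding G H) {A : Type v} [NormedRing A]
    [NormedAlgebra ℂ A] (h1 : ‖(1 : A)‖ ≤ 1) {S T : G.E → A} {P : G.V → A}
    (h : G.IsCKFamily S T P) :
    H.IsRelativeCKFamily (Set.range i.onE) (Function.extend i.onE S 0)
      (Function.extend i.onE T 0) (Function.extend i.onV P 0) := by
  have hS : ∀ a, Function.extend i.onE S (0 : H.E → A) (i.onE a) = S a := i.onE_injective.extend_apply S (0 : H.E → A)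
  have hT : ∀ a, Function.extend i.onE T (0 : H.E → A) (i.onE a) = T a := i.onE_injective.extend_apply T (0 : H.E → A)
  have hP : ∀ x, Function.extend i.onV P (0 : H.V → A) (i.onV x) = P x := i.onV_injective.extend_apply P (0 : H.V → A)
  have hS0 : ∀ a ∉ Set.range i.onE, Function.extend i.onE S (0 : H.E → A) a = 0 :=
    fun a ha => Function.extend_apply' S (0 : H.E → A) a ha
  have hT0 : ∀ a ∉ Set.range i.onE, Function.extend i.onE T (0 : H.E → A) a = 0 :=
    fun a ha => Function.extend_apply' T (0 : H.E → A) a ha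
  have hP0 : ∀ x ∉ Set.range i.onV, Function.extend i.onV P (0 : H.V → A) x = 0 :=
    fun x hx => Function.extend_apply' P (0 : H.V → A) x hx
  have edge : ∀ {q : H.E → Prop}, (∀ a, q (i.onE a)) → (∀ a ∉ Set.range i.onE, q a) → ∀ a, q a :=
    fun h h' a => (em (a ∈ Set.range i.onE)).elim (fun ⟨b, hb⟩ => hb ▸ h b) (h' a)
  refine ⟨hS0, hT0, ?_, ?_, ?_, ?_, ?_, ?_, ?_, ?_, ?_, ?_, ?_, ?_⟩
  · intro x
    by_cases hx : x ∈ Set.range i.onV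
    · obtain ⟨x, rfl⟩ := hx
      rw [hP]
      exact h.e_hermitian x
    · rw [hP0 x hx]
      exact isHermitianIdem_zero h1
  · intro x y hne
    by_cases hx : x ∈ Set.range i.onV
    · by_cases hy : y ∈ Set.range i.onV
      · obtain ⟨x, rfl⟩ := hx
        obtain ⟨y, rfl⟩ := hy
        rw [hP, hP]
        exact h.e_orthogonal x y fun e => hne (congrArg i.onV e)
      · rw [hP0 y hy, mul_zero]
    · rw [hP0 x hx, zero_mul]
  · exact edge (fun a => by rw [hS]; exact h.norm_s_le a) fun a ha => by simp [hS0 a ha]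
  · exact edge (fun a => by rw [hT]; exact h.norm_t_le a) fun a ha => by simp [hT0 a ha]
  · exact edge (fun a => by rw [hS, hT]; exact h.st_hermitian a) fun a ha => by
      rw [hS0 a ha, zero_mul]; exact isHermitianIdem_zero h1
  · exact edge (fun a => by rw [i.r_onE, hS, hP, h.e_mul_s]) fun a ha => by simp [hS0 a ha]
  · exact edge (fun a => by rw [i.s_onE, hS, hP, h.s_mul_e]) fun a ha => by simp [hS0 a ha]
  · exact edge (fun a => by rw [i.r_onE, hT, hP, h.t_mul_e]) fun a ha => by simp [hT0 a ha]
  · exact edge (fun a => by rw [i.s_onE, hT, hP, h.e_mul_t]) fun a ha => by simp [hT0 a ha]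
  · rintro _ ⟨a, rfl⟩
    rw [i.s_onE, hS, hT, hP, h.t_mul_s_self]
  · intro a b hne
    by_cases ha : a ∈ Set.range i.onE
    · by_cases hb : b ∈ Set.range i.onE
      · obtain ⟨a, rfl⟩ := ha
        obtain ⟨b, rfl⟩ := hb
        rw [hS, hT]
        exact h.t_mul_s a b fun e => hne (congrArg i.onE e)
      · rw [hS0 b hb, mul_zero]
    · rw [hT0 a ha, zero_mul]
  -- The vertex receives an edge of `G`, and finitely many edges in `H`, hence finitely many in `G`.
  -- The Cuntz–Krieger condition then puts all its incoming edges into `G`, so the sums over `G` and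
  -- over `H` agree.
  · rintro x hx ⟨_, ⟨a, rfl⟩, rfl⟩
    have hpre : {b | G.r b = G.r a} = i.onE ⁻¹' {b | H.r b = H.r (i.onE a)} := by
      ext b
      simp only [Set.mem_ofPred_eq, Set.mem_preimage, i.r_onE]
      exact i.onV_injective.eq_iff.symm
    have hfin : {b | G.r b = G.r a}.Finite := hpre ▸ hx.preimage i.onE_injective.injOn
    have hmap : hx.toFinset = hfin.toFinset.map ⟨i.onE, i.onE_injective⟩ := by
      ext b
      simp only [Set.Finite.mem_toFinset, Set.mem_ofPred_eq, Finset.mem_map,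
        Function.Embedding.coeFn_mk]
      constructor
      · intro hb
        obtain ⟨c, rfl⟩ := i.isCuntzKrieger (G.r a) ⟨a, rfl⟩ hfin b (hb.trans (i.r_onE a))
        exact ⟨c, i.onV_injective (by rw [← i.r_onE, ← i.r_onE, hb]), rfl⟩
      · rintro ⟨c, hc, rfl⟩
        rw [i.r_onE, i.r_onE, hc]
    rw [hmap, Finset.sum_map, i.r_onE, hP, h.ck2 (G.r a) hfin ⟨a, rfl⟩]
    exact Finset.sum_congr rfl fun b _ => by
      simp only [Function.Embedding.coeFn_mk, hS, hT]

/-! ### Intertwiners and isometry of the canonical maps -/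

theorem leavittMap_gen_s {G H : DirGraph.{u}} (i : CKEmbedding G H) (a : G.E) :
    leavittMap i (G.leavittS a) = H.leavittS (i.onE a) := leavittLift_s _ a

theorem leavittMap_gen_t {G H : DirGraph.{u}} (i : CKEmbedding G H) (a : G.E) :
    leavittMap i (G.leavittT a) = H.leavittT (i.onE a) := leavittLift_t _ a

theorem leavittMap_gen_e {G H : DirGraph.{u}} (i : CKEmbedding G H) (x : G.V) :
    leavittMap i (G.leavittE x) = H.leavittE (i.onV x) := leavittLift_e _ x

/-- The elements whose images are intertwined by `J` form a subalgebra, so the generators suffice.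
-/
theorem leavitt_intertwines {Q : DirGraph.{u}} {E : Type v} {E' : Type w} [NormedAddCommGroup E]
    [NormedSpace ℂ E] [NormedAddCommGroup E'] [NormedSpace ℂ E'] {φ : Q.Leavitt →ₙₐ[ℂ] E →L[ℂ] E}
    {ψ : Q.Leavitt →ₙₐ[ℂ] E' →L[ℂ] E'} {J : E →L[ℂ] E'}
    (h : ∀ g ξ, ψ (Q.leavittGen g) (J ξ) = J (φ (Q.leavittGen g) ξ)) (x : Q.Leavitt) (ξ : E) :
    ψ x (J ξ) = J (φ x ξ) := by
  induction x using leavitt_induction generalizing ξ with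
  | gen g => exact h g ξ
  | add x y hx hy => rw [map_add, map_add, add_apply, add_apply, hx, hy, map_add]
  | zero => rw [map_zero, map_zero, zero_apply, zero_apply, map_zero]
  | mul x y hx hy => rw [map_mul, map_mul, mul_apply_eq_comp, mul_apply_eq_comp, hy, hx]
  | smul c x hx => rw [map_smul, map_smul, smul_apply, smul_apply, hx, map_smul]

theorem leavittLift_intertwines {G H : DirGraph.{u}} (i : CKEmbedding G H) {E : Type v}
    {E' : Type w} [NormedAddCommGroup E] [NormedSpace ℂ E] [NormedAddCommGroup E']
    [NormedSpace ℂ E'] {φ : G.Leavitt →ₙₐ[ℂ] E →L[ℂ] E} {S T : H.E → E' →L[ℂ] E'}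
    {P : H.V → E' →L[ℂ] E'} (hL : H.IsLeavittFamily S T P) {J : E →L[ℂ] E'}
    (hS : ∀ a ξ, S (i.onE a) (J ξ) = J (φ (G.leavittS a) ξ))
    (hT : ∀ a ξ, T (i.onE a) (J ξ) = J (φ (G.leavittT a) ξ))
    (hP : ∀ x ξ, P (i.onV x) (J ξ) = J (φ (G.leavittE x) ξ)) (x : G.Leavitt) (ξ : E) :
    leavittLift hL (leavittMap i x) (J ξ) = J (φ x ξ) := by
  refine leavitt_intertwines (ψ := (leavittLift hL).comp (leavittMap i)) (fun g ξ => ?_) x ξ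
  rw [NonUnitalAlgHom.comp_apply]
  cases g with
  | s a => rw [leavittMap_gen_s, leavittLift_s, hS]
  | t a => rw [leavittMap_gen_t, leavittLift_t, hT]
  | e x => rw [leavittMap_gen_e, leavittLift_e, hP]

/-- Conjugation by a surjective isometry. -/
noncomputable def isometryConj {E : Type v} {E' : Type w} [NormedAddCommGroup E]
    [NormedSpace ℂ E] [NormedAddCommGroup E'] [NormedSpace ℂ E'] (e : E ≃ₗᵢ[ℂ] E') :
    (E →L[ℂ] E) ≃A[ℂ] (E' →L[ℂ] E') :=
  e.toContinuousLinearEquiv.conjContinuousAlgEquiv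

theorem isometryConj_apply {E : Type v} {E' : Type w} [NormedAddCommGroup E]
    [NormedSpace ℂ E] [NormedAddCommGroup E'] [NormedSpace ℂ E'] (e : E ≃ₗᵢ[ℂ] E')
    (B : E →L[ℂ] E) (f : E) : isometryConj e B (e f) = e (B f) := by
  change e (B (e.symm (e f))) = _
  rw [e.symm_apply_apply]

theorem norm_isometryConj_le {E : Type v} {E' : Type w} [NormedAddCommGroup E]
    [NormedSpace ℂ E] [NormedAddCommGroup E'] [NormedSpace ℂ E'] (e : E ≃ₗᵢ[ℂ] E')
    (B : E →L[ℂ] E) : ‖isometryConj e B‖ ≤ ‖B‖ :=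
  ContinuousLinearMap.opNorm_le_bound _ (norm_nonneg _) fun f => by
    rw [← e.apply_symm_apply f, isometryConj_apply, e.norm_map, e.norm_map]
    exact B.le_opNorm _

/-- Every representation of `L_G` on an `Lᵖ`-space is a subrepresentation of the restriction of
a representation of `L_H` on an `Lᵖ`-space, if `G` is a Cuntz–Krieger subgraph of `H`. -/
theorem IsRepresentation.exists_dilation {p : ℝ≥0∞} [Fact (1 ≤ p)] (hp : p ≠ ∞)
    {G H : DirGraph.{u}} (i : CKEmbedding G H) {X : Type u} [MeasurableSpace X] {μ : Measure X}
    {φ : G.Leavitt →ₙₐ[ℂ] LpOp p μ} (hφ : IsRepresentation φ) :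
    ∃ (Y : Type u) (_ : MeasurableSpace Y) (ν : Measure Y) (ψ : H.Leavitt →ₙₐ[ℂ] LpOp p ν)
      (J : Lp ℂ p μ →L[ℂ] Lp ℂ p ν), IsRepresentation ψ ∧ (∀ ξ, ‖J ξ‖ = ‖ξ‖) ∧
        ∀ x ξ, ψ (leavittMap i x) (J ξ) = J (φ x ξ) := by
  have hR := IsCKFamily.extend i (ContinuousLinearMap.norm_id_le (𝕜 := ℂ)) hφ
  let ι := IsRelativeCKFamily.baseIncl H (Lp ℂ p μ) p
  let e := lpSigmaEquiv (Node H) μ hp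
  -- Conjugation by `e` moves the dilation from the `ℓᵖ`-sum to a genuine `Lᵖ`-space, as the
  -- definition of the norm requires.
  have hC := (hR.isCKFamily_dilation hp).map (isometryConj e) (norm_isometryConj_le e)
  refine ⟨_, _, _, leavittLift hC.isLeavittFamily,
    e.toContinuousLinearEquiv.toContinuousLinearMap ∘L ι, hC.isRepresentation, fun ξ => ?_,
    leavittLift_intertwines i _ (fun a ξ => ?_) (fun a ξ => ?_) (fun x ξ => ?_)⟩
  · exact (e.norm_map _).trans (IsRelativeCKFamily.norm_baseIncl ξ)
  · refine (isometryConj_apply e _ (ι ξ)).trans (congrArg e ?_)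
    rw [hR.dilationS_baseIncl hp ⟨a, rfl⟩, i.onE_injective.extend_apply]
    rfl
  · refine (isometryConj_apply e _ (ι ξ)).trans (congrArg e ?_)
    rw [hR.dilationT_baseIncl hp ⟨a, rfl⟩, i.onE_injective.extend_apply]
    rfl
  · refine (isometryConj_apply e _ (ι ξ)).trans (congrArg e ?_)
    rw [hR.dilationP_baseIncl hp, i.onV_injective.extend_apply]
    rfl

/-- One inequality restricts representations of `L_H`. The other dilates representations of `L_G`:
since `J` is isometric and intertwines, the norm of `φ x` is at most that of `ψ (leavittMap i x)`.
-/
theorem graphNorm_leavittMap {p : ℝ≥0∞} [Fact (1 ≤ p)] (hp : p ≠ ∞) {G H : DirGraph.{u}}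
    (i : CKEmbedding G H) (x : G.Leavitt) : graphNorm p (leavittMap i x) = graphNorm p x := by
  refine le_antisymm (graphNorm_leavittMap_le p i x) (graphNorm_le p fun X m μ φ hφ => ?_)
  obtain ⟨Y, _, ν, ψ, J, hψ, hJ, h⟩ := hφ.exists_dilation hp i
  refine (ContinuousLinearMap.opNorm_le_bound _ (norm_nonneg (ψ (leavittMap i x))) fun ξ => ?_).trans
    (norm_le_graphNorm p hψ _)
  rw [← hJ (φ x ξ), ← h, ← hJ ξ]
  exact ContinuousLinearMap.le_opNorm _ _

theorem isometry_graphAlgebraMap {p : ℝ≥0∞} [Fact (1 ≤ p)] (hp : p ≠ ∞) {G H : DirGraph.{u}}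
    (i : CKEmbedding G H) : Isometry (graphAlgebraMap p i) := by
  have hc : Continuous (graphAlgebraMap p i) := UniformSpace.Completion.continuous_map
  have h : ∀ x, ‖graphAlgebraMap p i (GraphAlgebra.ofLeavitt p x)‖ = ‖GraphAlgebra.ofLeavitt p x‖ :=
    fun x => by
      rw [graphAlgebraMap_ofLeavitt, GraphAlgebra.norm_ofLeavitt, GraphAlgebra.norm_ofLeavitt,
        graphNorm_leavittMap hp]
  exact AddMonoidHomClass.isometry_of_norm _ fun x =>
    UniformSpace.Completion.induction_on x (isClosed_eq hc.norm continuous_norm) h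

end DirGraph

/-! ### Direct limits of Banach algebras with dense union -/

section DirectLimit

variable {I : Type u} [Preorder I] [IsDirected I (· ≤ ·)] {A : I → Type u}
  [∀ i, NonUnitalNormedRing (A i)] [∀ i, NormedSpace ℂ (A i)] {f : ∀ i j, i ≤ j → A i →ₙₐ[ℂ] A j}
  {L : Type u} [NonUnitalNormedRing L] [NormedSpace ℂ L] {g : ∀ i, A i →ₙₐ[ℂ] L}
  {B : Type w} [NonUnitalNormedRing B] [NormedSpace ℂ B] {h : ∀ i, A i →ₙₐ[ℂ] B}

/-- Two elements of the union of a directed system come from a common stage. -/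
theorem exists_common_stage (hg : ∀ i j (hij : i ≤ j), (g j).comp (f i j hij) = g i)
    (hh : ∀ i j (hij : i ≤ j), (h j).comp (f i j hij) = h i) (i j : I) (a : A i) (b : A j) :
    ∃ (k : I) (a' b' : A k), g k a' = g i a ∧ h k a' = h i a ∧ g k b' = g j b ∧ h k b' = h j b := by
  obtain ⟨k, hik, hjk⟩ := exists_ge_ge i j
  exact ⟨k, f i k hik a, f j k hjk b, DFunLike.congr_fun (hg i k hik) a,
    DFunLike.congr_fun (hh i k hik) a, DFunLike.congr_fun (hg j k hjk) b,
    DFunLike.congr_fun (hh j k hjk) b⟩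

variable [Nonempty I]

/-- The union of the images of a directed system, as a subspace. -/
def unionSubmodule (hg : ∀ i j (hij : i ≤ j), (g j).comp (f i j hij) = g i) : Submodule ℂ L where
  carrier := {x | ∃ i a, g i a = x}
  add_mem' := by
    rintro _ _ ⟨i, a, rfl⟩ ⟨j, b, rfl⟩
    obtain ⟨k, a', b', ha, -, hb, -⟩ := exists_common_stage hg hg i j a b
    exact ⟨k, a' + b', by rw [map_add, ha, hb]⟩
  zero_mem' := ⟨Classical.arbitrary I, 0, map_zero _⟩
  smul_mem' := by
    rintro c _ ⟨i, a, rfl⟩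
    exact ⟨i, c • a, map_smul _ _ _⟩

/-- Two representatives of an element can be moved to a common stage, where they agree because `g k`
is injective. The value on the union is therefore independent of the choice of stage. -/
theorem exists_linear_lift (hg : ∀ i j (hij : i ≤ j), (g j).comp (f i j hij) = g i)
    (hiso : ∀ i, Isometry (g i)) (hh : ∀ i j (hij : i ≤ j), (h j).comp (f i j hij) = h i) :
    ∃ k : unionSubmodule hg →ₗ[ℂ] B, ∀ x i a, g i a = x.1 → k x = h i a := by
  have key : ∀ i j a b, g i a = g j b → h i a = h j b := fun i j a b e => by
    obtain ⟨k, a', b', ha, ha', hb, hb'⟩ := exists_common_stage hg hh i j a b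
    rw [← ha', ← hb', (hiso k).injective (ha.trans (e.trans hb.symm))]
  have hk : ∀ (x : unionSubmodule hg) i a, g i a = x.1 →
      h x.2.choose x.2.choose_spec.choose = h i a :=
    fun x i a e => key _ _ _ _ (x.2.choose_spec.choose_spec.trans e.symm)
  refine ⟨{ toFun := fun x => h x.2.choose x.2.choose_spec.choose
            map_add' := ?_
            map_smul' := ?_ }, hk⟩
  · rintro ⟨_, i, a, rfl⟩ ⟨_, j, b, rfl⟩
    obtain ⟨k, a', b', ha, ha', hb, hb'⟩ := exists_common_stage hg hh i j a b
    rw [hk _ k (a' + b') (by rw [map_add, ha, hb]; rfl), hk _ k a' ha, hk _ k b' hb, map_add]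
  · rintro c ⟨_, i, a, rfl⟩
    rw [hk _ i (c • a) (map_smul _ _ _), hk _ i a rfl, map_smul]
    rfl

/-- The map on the dense union is contractive since every `g i` preserves norms, so it extends
continuously; contractive lifts agreeing on the union are equal. -/
theorem existsUnique_lift [CompleteSpace B]
    (hg : ∀ i j (hij : i ≤ j), (g j).comp (f i j hij) = g i) (hiso : ∀ i, Isometry (g i))
    (hd : Dense {x | ∃ i a, g i a = x})
    (hh : ∀ i j (hij : i ≤ j), (h j).comp (f i j hij) = h i) (hc : ∀ i x, ‖h i x‖ ≤ ‖x‖) :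
    ∃! k : L →ₙₐ[ℂ] B, (∀ x, ‖k x‖ ≤ ‖x‖) ∧ ∀ i, k.comp (g i) = h i := by
  have hn : ∀ i a, ‖g i a‖ = ‖a‖ := fun i a =>
    (AddMonoidHomClass.isometry_iff_norm (g i)).mp (hiso i) a
  obtain ⟨k₀, hk₀⟩ := exists_linear_lift hg hiso hh
  have hb : ∀ x, ‖k₀ x‖ ≤ 1 * ‖(unionSubmodule hg).subtype x‖ := by
    rintro ⟨_, i, a, rfl⟩
    rw [hk₀ _ i a rfl, one_mul]
    exact (hc i a).trans (hn i a).ge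
  have hdr : DenseRange (unionSubmodule hg).subtype := by
    rw [DenseRange, Submodule.coe_subtype, Subtype.range_coe]
    exact hd
  let k₁ : L →L[ℂ] B := k₀.extendOfNorm (unionSubmodule hg).subtype
  have hk₁ : ∀ i a, k₁ (g i a) = h i a := fun i a =>
    (LinearMap.extendOfNorm_eq hdr ⟨1, hb⟩ ⟨g i a, i, a, rfl⟩).trans (hk₀ _ i a rfl)
  -- By continuity it suffices to multiply elements of the union, and any two of these come from one
  -- stage.
  have hmul : ∀ x y, k₁ (x * y) = k₁ x * k₁ y := fun x y => by
    refine hd.denseRange_val.induction_on₂ (p := fun x y => k₁ (x * y) = k₁ x * k₁ y)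
      (isClosed_eq (by fun_prop) (by fun_prop)) ?_ x y
    rintro ⟨_, i, a, rfl⟩ ⟨_, j, b, rfl⟩
    obtain ⟨k, a', b', ha, -, hb, -⟩ := exists_common_stage hg hh i j a b
    change k₁ (g i a * g j b) = k₁ (g i a) * k₁ (g j b)
    rw [← ha, ← hb, ← map_mul, hk₁, hk₁, hk₁, map_mul]
  let k : L →ₙₐ[ℂ] B :=
    { toFun := k₁
      map_smul' := map_smul k₁
      map_zero' := map_zero k₁
      map_add' := map_add k₁
      map_mul' := hmul }
  refine ⟨k, ⟨fun x => ?_, fun i => NonUnitalAlgHom.ext (hk₁ i)⟩, ?_⟩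
  · refine hd.induction (P := fun x => ‖k₁ x‖ ≤ ‖x‖) ?_ (isClosed_le (by fun_prop) (by fun_prop)) x
    rintro _ ⟨i, a, rfl⟩
    rw [hk₁, hn]
    exact hc i a
  · rintro k' ⟨hk', hk'g⟩
    have hcont : Continuous k' := (AddMonoidHomClass.lipschitz_of_bound k' 1 fun x => by
      rw [one_mul]; exact hk' x).continuous
    refine NonUnitalAlgHom.ext fun x => ?_
    refine hd.induction (P := fun x => k' x = k₁ x) ?_ (isClosed_eq hcont k₁.continuous) x
    rintro _ ⟨i, a, rfl⟩
    rw [hk₁, ← hk'g i]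
    rfl

/-- The contractive lift preserves norms on the dense union, hence everywhere; uniqueness is
inherited because isometric homomorphisms are contractive. -/
theorem existsUnique_isometric_lift [CompleteSpace B]
    (hg : ∀ i j (hij : i ≤ j), (g j).comp (f i j hij) = g i) (hiso : ∀ i, Isometry (g i))
    (hd : Dense {x | ∃ i a, g i a = x})
    (hh : ∀ i j (hij : i ≤ j), (h j).comp (f i j hij) = h i) (hc : ∀ i, Isometry (h i)) :
    ∃! k : L →ₙₐ[ℂ] B, Isometry k ∧ ∀ i, k.comp (g i) = h i := by
  have norm_eq : ∀ {C : Type _} [NonUnitalNormedRing C] [NormedSpace ℂ C] {i} {φ : A i →ₙₐ[ℂ] C},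
      Isometry φ → ∀ a, ‖φ a‖ = ‖a‖ := fun hφ => (AddMonoidHomClass.isometry_iff_norm _).mp hφ
  obtain ⟨k, ⟨hk, hkg⟩, hu⟩ := existsUnique_lift hg hiso hd hh fun i a => ((norm_eq (hc i)) a).le
  have hcont : Continuous k := (AddMonoidHomClass.lipschitz_of_bound k 1 fun x => by
    rw [one_mul]; exact hk x).continuous
  refine ⟨k, ⟨AddMonoidHomClass.isometry_of_norm k fun x => ?_, hkg⟩, fun k' hk' =>
    hu k' ⟨fun x => ((AddMonoidHomClass.isometry_iff_norm k').mp hk'.1 x).le, hk'.2⟩⟩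
  refine hd.induction (P := fun x => ‖k x‖ = ‖x‖) ?_ (isClosed_eq hcont.norm continuous_norm) x
  rintro _ ⟨i, a, rfl⟩
  have h1 : k (g i a) = h i a := DFunLike.congr_fun (hkg i) a
  have h2 : ‖g i a‖ = ‖a‖ := (AddMonoidHomClass.isometry_iff_norm (g i)).mp (hiso i) a
  rw [h1, h2]
  exact norm_eq (hc i) a

end DirectLimit

namespace DirGraph

/-! ### Countable Cuntz–Krieger subgraphs -/

section Closure

variable (Q : DirGraph.{u})

/-- The Cuntz–Krieger condition says nothing at vertices receiving infinitely many edges of the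
subgraph. An infinite fibre may thus be thinned to a countably infinite subset, while a finite one
is kept whole. -/
theorem exists_countable_incoming (x : Q.V) : ∃ N : Set Q.E, N ⊆ {a | Q.r a = x} ∧ N.Countable ∧
    (N.Finite → N = {a | Q.r a = x}) := by
  by_cases h : {a | Q.r a = x}.Finite
  · exact ⟨_, subset_rfl, h.countable, fun _ => rfl⟩
  · obtain ⟨N, hN, hc, hi⟩ := Set.Infinite.exists_subset_countable_infinite h
    exact ⟨N, hN, hc, fun hf => absurd hf hi⟩

/-- A countable set of edges with range `x`, which consists of all of them or is infinite. -/
noncomputable def incoming (x : Q.V) : Set Q.E := (Q.exists_countable_incoming x).choose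

theorem incoming_subset (x : Q.V) : Q.incoming x ⊆ {a | Q.r a = x} :=
  (Q.exists_countable_incoming x).choose_spec.1

theorem countable_incoming (x : Q.V) : (Q.incoming x).Countable :=
  (Q.exists_countable_incoming x).choose_spec.2.1

theorem incoming_eq (x : Q.V) (h : (Q.incoming x).Finite) : Q.incoming x = {a | Q.r a = x} :=
  (Q.exists_countable_incoming x).choose_spec.2.2 h

/-- The stages in the construction of the subgraph generated by sets of vertices and edges. -/
noncomputable def closureStage (W : Set Q.V) (F : Set Q.E) : ℕ → Set Q.V × Set Q.E
  | 0 => (W, F)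
  | n + 1 => ((closureStage W F n).1 ∪ (Q.r '' (closureStage W F n).2 ∪
      Q.s '' (closureStage W F n).2),
      (closureStage W F n).2 ∪ ⋃ x ∈ (closureStage W F n).1, Q.incoming x)

theorem countable_closureStage {W : Set Q.V} {F : Set Q.E} (hW : W.Countable) (hF : F.Countable)
    (n : ℕ) : (Q.closureStage W F n).1.Countable ∧ (Q.closureStage W F n).2.Countable := by
  induction n with
  | zero => exact ⟨hW, hF⟩
  | succ n ih =>
    exact ⟨ih.1.union ((ih.2.image _).union (ih.2.image _)),
      ih.2.union (ih.1.biUnion fun x _ => Q.countable_incoming x)⟩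

/-- The subgraph generated by sets of vertices and edges and closed under adjoining the edges
`Q.incoming x`. -/
noncomputable def closure (W : Set Q.V) (F : Set Q.E) : Q.Subgraph where
  verts := ⋃ n, (Q.closureStage W F n).1
  edges := ⋃ n, (Q.closureStage W F n).2
  r_mem a ha := by
    obtain ⟨n, hn⟩ := Set.mem_iUnion.mp ha
    exact Set.mem_iUnion.mpr ⟨n + 1, .inr (.inl ⟨a, hn, rfl⟩)⟩
  s_mem a ha := by
    obtain ⟨n, hn⟩ := Set.mem_iUnion.mp ha
    exact Set.mem_iUnion.mpr ⟨n + 1, .inr (.inr ⟨a, hn, rfl⟩)⟩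

variable {Q} {W : Set Q.V} {F : Set Q.E}

theorem subset_closure_verts : W ⊆ (Q.closure W F).verts :=
  Set.subset_iUnion (fun n => (Q.closureStage W F n).1) 0

theorem subset_closure_edges : F ⊆ (Q.closure W F).edges :=
  Set.subset_iUnion (fun n => (Q.closureStage W F n).2) 0

theorem incoming_subset_closure {x : Q.V} (hx : x ∈ (Q.closure W F).verts) :
    Q.incoming x ⊆ (Q.closure W F).edges := by
  obtain ⟨n, hn⟩ := Set.mem_iUnion.mp hx
  exact fun a ha => Set.mem_iUnion.mpr ⟨n + 1, .inr (Set.mem_biUnion hn ha)⟩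

/-- A vertex with finitely many incoming edges in the closure has a finite set `incoming`, which is
then the whole fibre in `Q`. -/
theorem closure_isCuntzKrieger : (Q.closure W F).IsCuntzKrieger := by
  intro x hx _ hfin
  have hsub : Q.incoming x ⊆ {a ∈ (Q.closure W F).edges | Q.r a = x} := fun a ha =>
    ⟨incoming_subset_closure hx ha, Q.incoming_subset x ha⟩
  refine Set.Subset.antisymm (fun a ha => ha.2) ?_
  rw [← Q.incoming_eq x (hfin.subset hsub)]
  exact hsub

theorem closure_isCountable (hW : W.Countable) (hF : F.Countable) :
    (Q.closure W F).toGraph.IsCountable :=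
  ⟨(Set.countable_iUnion fun n => (Q.countable_closureStage hW hF n).1).to_subtype,
    (Set.countable_iUnion fun n => (Q.countable_closureStage hW hF n).2).to_subtype⟩

theorem closure_everyCycleHasEntry (hQ : Q.EveryCycleHasEntry) :
    (Q.closure W F).toGraph.EveryCycleHasEntry := by
  intro n α hα
  obtain ⟨a, i, hr, hne⟩ := hQ n (fun i => (α i).1)
    ⟨fun i => congrArg Subtype.val (hα.1 i), congrArg Subtype.val hα.2.1,
      fun i j h => hα.2.2 (Subtype.ext h)⟩
  -- The entry found in `Q` need not lie in the closure. It does if `incoming` is the whole fibre;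
  -- otherwise `incoming` is infinite and contains some other edge.
  obtain ⟨b, hb, hbne⟩ : ∃ b ∈ Q.incoming (Q.r (α i).1), b ≠ (α i).1 := by
    by_cases hfin : (Q.incoming (Q.r (α i).1)).Finite
    · exact ⟨a, by rw [Q.incoming_eq _ hfin]; exact hr, hne⟩
    · exact Set.Infinite.exists_notMem_finset hfin {(α i).1} |>.imp fun b hb => by simpa using hb
  refine ⟨⟨b, incoming_subset_closure ((Q.closure W F).r_mem _ (α i).2) hb⟩, i,
    Subtype.ext (Q.incoming_subset _ hb), fun e => hbne (congrArg Subtype.val e)⟩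

end Closure
end DirGraph

/-! ### Functoriality and the direct limit theorem -/

namespace DirGraph

variable (p : ℝ≥0∞) [Fact (1 ≤ p)]

theorem continuous_graphAlgebraMap {G H : DirGraph.{u}} (i : CKEmbedding G H) :
    Continuous (graphAlgebraMap p i) :=
  UniformSpace.Completion.continuous_map

variable {p} in
/-- Continuous homomorphisms from `𝒪ᵖ(G)` are determined by their restrictions to `L_G`. -/
theorem graphAlgebra_hom_ext {G : DirGraph.{u}} {B : Type v} [NonUnitalNormedRing B]
    [NormedSpace ℂ B] {φ ψ : G.GraphAlgebra p →ₙₐ[ℂ] B} (hφ : Continuous φ) (hψ : Continuous ψ)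
    (h : φ.comp (GraphAlgebra.ofLeavitt p) = ψ.comp (GraphAlgebra.ofLeavitt p)) : φ = ψ :=
  NonUnitalAlgHom.ext fun x => UniformSpace.Completion.induction_on x (isClosed_eq hφ hψ)
    (DFunLike.congr_fun h)

theorem graphAlgebraMap_id {G : DirGraph.{u}} (i : CKEmbedding G G) (hV : ∀ x, i.onV x = x)
    (hE : ∀ a, i.onE a = a) : graphAlgebraMap p i = NonUnitalAlgHom.id ℂ (G.GraphAlgebra p) := by
  have h : leavittMap i = NonUnitalAlgHom.id ℂ G.Leavitt := leavitt_hom_ext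
    (fun a => (leavittMap_gen_s i a).trans (by rw [hE]; rfl))
    (fun a => (leavittMap_gen_t i a).trans (by rw [hE]; rfl))
    (fun x => (leavittMap_gen_e i x).trans (by rw [hV]; rfl))
  refine graphAlgebra_hom_ext (continuous_graphAlgebraMap p i) continuous_id
    (NonUnitalAlgHom.ext fun x => ?_)
  rw [NonUnitalAlgHom.comp_apply, graphAlgebraMap_ofLeavitt, h]
  rfl

theorem graphAlgebraMap_comp {G H K : DirGraph.{u}} (i : CKEmbedding G H) (j : CKEmbedding H K)
    (k : CKEmbedding G K) (hV : ∀ x, j.onV (i.onV x) = k.onV x)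
    (hE : ∀ a, j.onE (i.onE a) = k.onE a) :
    (graphAlgebraMap p j).comp (graphAlgebraMap p i) = graphAlgebraMap p k := by
  have h : (leavittMap j).comp (leavittMap i) = leavittMap k := by
    refine leavitt_hom_ext (B := K.Leavitt) (fun a => ?_) (fun a => ?_) fun x => ?_ <;>
      rw [NonUnitalAlgHom.comp_apply]
    · rw [leavittMap_gen_s, leavittMap_gen_s, leavittMap_gen_s, hE]
    · rw [leavittMap_gen_t, leavittMap_gen_t, leavittMap_gen_t, hE]
    · rw [leavittMap_gen_e, leavittMap_gen_e, leavittMap_gen_e, hV]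
  refine graphAlgebra_hom_ext
    ((continuous_graphAlgebraMap p j).comp (continuous_graphAlgebraMap p i))
    (continuous_graphAlgebraMap p k) (NonUnitalAlgHom.ext fun x => ?_)
  rw [NonUnitalAlgHom.comp_apply, NonUnitalAlgHom.comp_apply, NonUnitalAlgHom.comp_apply,
    graphAlgebraMap_ofLeavitt, graphAlgebraMap_ofLeavitt, graphAlgebraMap_ofLeavitt, ← h]
  rfl

variable {p} in
/-- `𝒪ᵖ(Q)` is the direct limit of the algebras of any class of countable Cuntz–Krieger subgraphs
that contains all countable sets of vertices and edges. -/
theorem isIsometricDirectLimit_of_cofinal (hp : p ≠ ∞) (Q : DirGraph.{u})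
    (K : Q.Subgraph → Prop) (hCK : ∀ R, K R → R.IsCuntzKrieger)
    (hcount : ∀ R, K R → R.toGraph.IsCountable)
    (hK : ∀ (W : Set Q.V) (F : Set Q.E), W.Countable → F.Countable →
      ∃ R, K R ∧ W ⊆ R.verts ∧ F ⊆ R.edges) :
    IsIsometricDirectLimit.{u, w} (fun R : {R // K R} => R.1.toGraph.GraphAlgebra p)
      (fun R _ h => graphAlgebraMap p (Subgraph.inclOfLE h (hCK R.1 R.2)))
      (Q.GraphAlgebra p) (fun R => graphAlgebraMap p (R.1.incl (hCK R.1 R.2))) := by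
  have hne : Nonempty {R // K R} :=
    let ⟨R, hR, _⟩ := hK ∅ ∅ Set.countable_empty Set.countable_empty
    ⟨⟨R, hR⟩⟩
  have hdir : IsDirected {R // K R} (· ≤ ·) := ⟨fun R R' => by
    have hV := fun R : {R // K R} => Set.countable_coe_iff.mp (hcount R.1 R.2).1
    have hE := fun R : {R // K R} => Set.countable_coe_iff.mp (hcount R.1 R.2).2
    -- The vertices and edges of two countable subgraphs together are again countable data.
    obtain ⟨R₀, h₀, hW, hF⟩ := hK _ _ ((hV R).union (hV R')) ((hE R).union (hE R'))
    exact ⟨⟨R₀, h₀⟩,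
      ⟨Set.subset_union_left.trans hW, Set.subset_union_left.trans hF⟩,
      ⟨Set.subset_union_right.trans hW, Set.subset_union_right.trans hF⟩⟩⟩
  have hcompat : ∀ (R R' : {R // K R}) (h : R ≤ R'),
      (graphAlgebraMap p (R'.1.incl (hCK R'.1 R'.2))).comp
        (graphAlgebraMap p (Subgraph.inclOfLE h (hCK R.1 R.2))) =
      graphAlgebraMap p (R.1.incl (hCK R.1 R.2)) :=
    fun R R' h => graphAlgebraMap_comp p _ _ _ (fun _ => rfl) fun _ => rfl
  have hiso : ∀ R : {R // K R}, Isometry (graphAlgebraMap p (R.1.incl (hCK R.1 R.2))) :=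
    fun R => isometry_graphAlgebraMap hp _
  -- Each generator involves a single vertex or edge, so it comes from some stage; sums and products
  -- are formed at a common stage. Hence the union of the stages contains the dense image of `L_Q`.
  have hmem : ∀ x : Q.Leavitt, ∃ (R : {R // K R}) (a : R.1.toGraph.GraphAlgebra p),
      graphAlgebraMap p (R.1.incl (hCK R.1 R.2)) a = GraphAlgebra.ofLeavitt p x := by
    intro x
    induction x using leavitt_induction with
    | gen g =>
      cases g with
      | s a =>
        obtain ⟨R, hR, -, hF⟩ := hK ∅ {a} Set.countable_empty (Set.countable_singleton a)
        exact ⟨⟨R, hR⟩, _, (graphAlgebraMap_ofLeavitt p _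
          (R.toGraph.leavittS ⟨a, hF rfl⟩)).trans (congrArg _ (leavittMap_gen_s _ _))⟩
      | t a =>
        obtain ⟨R, hR, -, hF⟩ := hK ∅ {a} Set.countable_empty (Set.countable_singleton a)
        exact ⟨⟨R, hR⟩, _, (graphAlgebraMap_ofLeavitt p _
          (R.toGraph.leavittT ⟨a, hF rfl⟩)).trans (congrArg _ (leavittMap_gen_t _ _))⟩
      | e v =>
        obtain ⟨R, hR, hW, -⟩ := hK {v} ∅ (Set.countable_singleton v) Set.countable_empty
        exact ⟨⟨R, hR⟩, _, (graphAlgebraMap_ofLeavitt p _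
          (R.toGraph.leavittE ⟨v, hW rfl⟩)).trans (congrArg _ (leavittMap_gen_e _ _))⟩
    | add x y hx hy =>
      obtain ⟨R, a, ha⟩ := hx
      obtain ⟨R', b, hb⟩ := hy
      obtain ⟨R₀, a', b', ha', -, hb', -⟩ := exists_common_stage hcompat hcompat R R' a b
      exact ⟨R₀, a' + b', by rw [map_add, map_add, ha', hb', ha, hb]⟩
    | zero => exact ⟨hne.some, 0, by rw [map_zero, map_zero]⟩
    | mul x y hx hy =>
      obtain ⟨R, a, ha⟩ := hx
      obtain ⟨R', b, hb⟩ := hy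
      obtain ⟨R₀, a', b', ha', -, hb', -⟩ := exists_common_stage hcompat hcompat R R' a b
      exact ⟨R₀, a' * b', by rw [map_mul, map_mul, ha', hb', ha, hb]⟩
    | smul c x hx =>
      obtain ⟨R, a, ha⟩ := hx
      exact ⟨R, c • a, by rw [map_smul, map_smul, ha]⟩
  have hd : Dense {x : Q.GraphAlgebra p | ∃ (R : {R // K R}) (a : R.1.toGraph.GraphAlgebra p),
      graphAlgebraMap p (R.1.incl (hCK R.1 R.2)) a = x} :=
    (GraphAlgebra.denseRange_ofLeavitt p).mono (Set.range_subset_iff.mpr hmem)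
  exact
    { nonempty := hne
      directed := hdir
      map_self := fun R => graphAlgebraMap_id p _ (fun _ => rfl) fun _ => rfl
      map_comp := fun R R' R'' _ _ =>
        graphAlgebraMap_comp p _ _ _ (fun _ => rfl) fun _ => rfl
      isometry_map := fun R R' _ => isometry_graphAlgebraMap hp _
      isometry_ι := hiso
      compatible := hcompat
      universal := fun B _ _ _ _ _ h hh hc => existsUnique_isometric_lift hcompat hiso hd hc hh
      universal_contractive := fun B _ _ _ _ _ h hh hc =>
        existsUnique_lift hcompat hiso hd hc hh }

end DirGraph

theorem mainTheorem8 (p : ℝ≥0∞) [Fact (1 ≤ p)] (hp : p ≠ ∞) :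
    -- the canonical map for a Cuntz–Krieger subgraph of a countable graph
    (∀ Q : DirGraph.{u}, Q.IsCountable → ∀ (R : Q.Subgraph) (hR : R.IsCuntzKrieger),
      ∃ Φ : R.toGraph.GraphAlgebra p →ₙₐ[ℂ] Q.GraphAlgebra p, Isometry Φ ∧
        ∀ x : R.toGraph.Leavitt, Φ (DirGraph.GraphAlgebra.ofLeavitt p x) =
          DirGraph.GraphAlgebra.ofLeavitt p (DirGraph.leavittMap (R.incl hR) x)) ∧
    -- the direct limit over all countable Cuntz–Krieger subgraphs of an arbitrary graph
    (∀ Q : DirGraph.{u}, IsIsometricDirectLimit.{u, w}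
      (fun R : Q.CK => R.1.toGraph.GraphAlgebra p)
      (fun R _ h => DirGraph.graphAlgebraMap p (DirGraph.Subgraph.inclOfLE h R.2.1))
      (Q.GraphAlgebra p)
      (fun R => DirGraph.graphAlgebraMap p (R.1.incl R.2.1))) ∧
    -- the direct limit over those in which every cycle has an entry
    (∀ Q : DirGraph.{u}, Q.EveryCycleHasEntry → IsIsometricDirectLimit.{u, w}
      (fun R : Q.CKEntry => R.1.toGraph.GraphAlgebra p)
      (fun R _ h => DirGraph.graphAlgebraMap p (DirGraph.Subgraph.inclOfLE h R.2.1.1))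
      (Q.GraphAlgebra p)
      (fun R => DirGraph.graphAlgebraMap p (R.1.incl R.2.1.1))) := by

  refine ⟨fun Q _ R hR => ?_, fun Q => ?_, fun Q hQ => ?_⟩
  · exact ⟨_, DirGraph.isometry_graphAlgebraMap hp _, DirGraph.graphAlgebraMap_ofLeavitt p _⟩
  · exact DirGraph.isIsometricDirectLimit_of_cofinal hp Q
      (fun R => R.IsCuntzKrieger ∧ R.toGraph.IsCountable) (fun R h => h.1) (fun R h => h.2)
      -- The subgraph containing the given countable data is `Q.closure W F`, here and in the last
      -- case.
      fun W F hW hF => ⟨_, ⟨DirGraph.closure_isCuntzKrieger, DirGraph.closure_isCountable hW hF⟩,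
        DirGraph.subset_closure_verts, DirGraph.subset_closure_edges⟩
  · exact DirGraph.isIsometricDirectLimit_of_cofinal hp Q
      (fun R => (R.IsCuntzKrieger ∧ R.toGraph.IsCountable) ∧ R.toGraph.EveryCycleHasEntry)
      (fun R h => h.1.1) (fun R h => h.1.2)
      fun W F hW hF => ⟨_, ⟨⟨DirGraph.closure_isCuntzKrieger, DirGraph.closure_isCountable hW hF⟩,
        DirGraph.closure_everyCycleHasEntry hQ⟩,
        DirGraph.subset_closure_verts, DirGraph.subset_closure_edges⟩
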